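/- **Setting.** Let $h(z)=e^z-1$, and let $h^{[n]}$ ($n\ge 0$) be its $n$-th iterate. For $\Re z>0$ let $h^{[-n]}$ be the $n$-th iterate of the inverse branch $h^{[-1]}(z)=\log(1+z)$ (principal logarithm), which maps $\{\Re z>0\}$ into itself. Put $P_1=\{z:\Re z<0,\ |\Im z|<\pi\}$ (left petal) and $P_2=\{z:\Re z>0,\ |\Im z|<\pi\}$ (right petal). *Formal objects.* For $t\in\mathbb C$ the formal regular iterate $h^{[t]}$ is the unique formal power series of the form $z+\tfrac t2 z^2+\cdots$ that commutes with $h$ under composition. The iterative logarithm $j(x)=\tfrac12x^2+\cdots$ is the unique formal power series of this form with $j\circ h=h'\cdot j$. Let $v(x)=\sum_{k\ge1}v_kx^k$ be the formal series with $\frac1{j(x)}=\frac2{x^2}+\frac1{3x}+v'(x)$, and let $v_N(x)=\sum_{k=1}^Nv_kx^k$. *Regular Abel functions.* A regular Abel function of $h$ on $P\in\{P_1,P_2\}$ is an injective analytic function $\alpha:P\to\mathbb C$ such that $\alpha(h(z))=\alpha(z)+1$ whenever $z,h(z)\in P$ and such that, for every $t\in\mathbb C$, the function $z\mapsto\alpha^{-1}(t+\alpha(z))$,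 defined on $E_t=\{z\in P:\alpha(z)+t\in\alpha(P)\}$, is a regular iteration of $h$: $0$ lies in the closure of $E_t$, and this function has the formal series $h^{[t]}$ as its asymptotic expansion as $z\to0$ in $E_t$. **Theorem.** 1. The limits $$\alpha^{(1)}_{\rm W}(z)=\lim_{n\to\infty}\Bigl(-\tfrac13\log n-\frac{2}{h^{[n]}(z)}-n\Bigr)\quad(\Re z<0),$$ $$\alpha^{(2)}_{\rm W}(z)=\lim_{n\to\infty}\Bigl(-\tfrac13\log n-\frac{2}{h^{[-n]}(z)}+n\Bigr)\quad(\Re z>0)$$ exist and are analytic functions of $z$ on these half-planes. There they satisfy $\alpha^{(1)}_{\rm W}(h(z))=\alpha^{(1)}_{\rm W}(z)+1$ and $\alpha^{(2)}_{\rm W}(h^{[-1]}(z))=\alpha^{(2)}_{\rm W}(z)-1$. 2. $\alpha^{(1)}_{\rm W}$ and $\alpha^{(2)}_{\rm W}$ are the two regular Abel functions of $h$: for $i=1,2$, a function on $P_i$ is a regular Abel function of $h$ on $P_i$ if and only if it equals $\alpha^{(i)}_{\rm W}+c$ on $P_i$ for some constant $c\in\mathbb C$. 3. They differ from Écalle's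 limits by an additive constant: for every $N\in\mathbb N$, $$\lim_{n\to\infty}\Bigl(\tfrac13\log\bigl(-h^{[n]}(z)\bigr)-\frac{2}{h^{[n]}(z)}+v_N\bigl(h^{[n]}(z)\bigr)-n\Bigr)=\alpha^{(1)}_{\rm W}(z)+\tfrac13\log2\quad(\Re z<0),$$ $$\lim_{n\to\infty}\Bigl(\tfrac13\log\bigl(h^{[-n]}(z)\bigr)-\frac{2}{h^{[-n]}(z)}+v_N\bigl(h^{[-n]}(z)\bigr)+n\Bigr)=\alpha^{(2)}_{\rm W}(z)+\tfrac13\log2\quad(\Re z>0).$$ -/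

import Mathlib

noncomputable section

namespace WalkerAbel

/-- The base function `h(z) = e^z - 1`, with parabolic fixed point `0`. -/
def h (z : ℂ) : ℂ := Complex.exp z - 1

/-- The branch of `h⁻¹` that fixes `0`; it maps the right half-plane into itself. -/
def hInv (z : ℂ) : ℂ := Complex.log (1 + z)

/-- The power series of `h` at `0`. -/
def hSeries : PowerSeries ℂ := PowerSeries.exp ℂ - 1

/-- `g` is the regular iterate `f^{[t]}` of the formal power series
`f = X + f_m X^m + ⋯` (`m ≥ 2`, `f_m ≠ 0`): it has the form `g = X + t f_m X^m + ⋯` and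
satisfies `g ∘ f = f ∘ g` (`PowerSeries.subst a b` is `b ∘ a`). -/
structure IsFormalIterate (f : PowerSeries ℂ) (m : ℕ) (t : ℂ) (g : PowerSeries ℂ) : Prop where
  coeff_zero : PowerSeries.coeff 0 g = 0
  coeff_one : PowerSeries.coeff 1 g = 1
  coeff_lt : ∀ n, 2 ≤ n → n < m → PowerSeries.coeff n g = 0
  coeff_m : PowerSeries.coeff m g = t * PowerSeries.coeff m f
  comm : PowerSeries.subst f g = PowerSeries.subst g f

/-- `j` is the iterative logarithm of `f = X + f_m X^m + ⋯`: it has the form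
`j = f_m X^m + ⋯` and satisfies the Julia equation `j ∘ f = f' · j`. -/
structure IsIterativeLog (f : PowerSeries ℂ) (m : ℕ) (j : PowerSeries ℂ) : Prop where
  coeff_lt : ∀ n, n < m → PowerSeries.coeff n j = 0
  coeff_m : PowerSeries.coeff m j = PowerSeries.coeff m f
  julia : PowerSeries.subst f j = PowerSeries.derivative ℂ f * j

/-- `v` is the power series part, without constant term, of the formal Abel function
`∫ 1/j = -2/x + (1/3) log (± x) + v(x)` of `e^x - 1`, where `j` is the iterative logarithm:
`1/j = 2/x² + 1/(3x) + v'`, written without denominators. -/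
def IsAbelTail (v : PowerSeries ℂ) : Prop :=
  PowerSeries.coeff 0 v = 0 ∧
  ∃ j : PowerSeries ℂ, IsIterativeLog hSeries 2 j ∧
    (PowerSeries.C 2 + PowerSeries.C (1 / 3) * PowerSeries.X
      + PowerSeries.X ^ 2 * PowerSeries.derivative ℂ v) * j = PowerSeries.X ^ 2

/-- `φ` has the formal power series `g` as (Poincaré) asymptotic expansion at `0` as `z → 0`
within `E`. -/
def HasAsymptoticExpansion (φ : ℂ → ℂ) (E : Set ℂ) (g : PowerSeries ℂ) : Prop :=
  ∀ N : ℕ, (fun z : ℂ => φ z - ∑ k ∈ Finset.range N, PowerSeries.coeff k g * z ^ k)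
    =O[nhdsWithin 0 E] (fun z : ℂ => z ^ N)

/-- For `α` injective on `P` with inverse `σ : α(P) → P`, the iterate `z ↦ σ(t + α(z))`. -/
def abelIterate (P : Set ℂ) (α : ℂ → ℂ) (t z : ℂ) : ℂ := Function.invFunOn α P (α z + t)

/-- The points of `P` at which `σ(t + α(z))` is defined. -/
def abelIterateDomain (P : Set ℂ) (α : ℂ → ℂ) (t : ℂ) : Set ℂ :=
  {z | z ∈ P ∧ α z + t ∈ α '' P}

/-- `α` is a regular Abel function on the domain `P` of the function `f` with power series
`fs = X + f_m X^m + ⋯` at `0`: it is analytic and injective on `P`, satisfies the Abel equation,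
and for every complex `t` the iterate `f^{[t]}(z) = σ(t + α(z))`, where `σ` is the inverse of
`α`, is a regular iteration of `f`: it is defined at points of `P` arbitrarily close to `0`,
and its asymptotic expansion at `0` is the formal regular iterate. -/
structure IsRegularAbel (f : ℂ → ℂ) (fs : PowerSeries ℂ) (m : ℕ) (P : Set ℂ) (α : ℂ → ℂ) :
    Prop where
  analytic : DifferentiableOn ℂ α P
  injective : Set.InjOn α P
  abel : ∀ z ∈ P, f z ∈ P → α (f z) = α z + 1
  defined : ∀ t : ℂ, (0 : ℂ) ∈ closure (abelIterateDomain P α t)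
  regular : ∀ t : ℂ, ∃ g : PowerSeries ℂ, IsFormalIterate fs m t g ∧
    HasAsymptoticExpansion (abelIterate P α t) (abelIterateDomain P α t) g

/-- The left petal of `h`, invariant under `h`, which is injective on it. -/
def leftPetal : Set ℂ := {z | z.re < 0 ∧ |z.im| < Real.pi}

/-- The right petal of `h`, invariant under `h⁻¹`; `h` is injective on it. -/
def rightPetal : Set ℂ := {z | 0 < z.re ∧ |z.im| < Real.pi}

/-- `-(1/3) log n - 2 / h^{[n]}(z) - n`. -/
def walkerLeftSeq (z : ℂ) (n : ℕ) : ℂ :=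
  -(1 / 3) * (Real.log n : ℂ) - 2 / (h^[n] z) - n

/-- `-(1/3) log n - 2 / h^{[-n]}(z) + n`. -/
def walkerRightSeq (z : ℂ) (n : ℕ) : ℂ :=
  -(1 / 3) * (Real.log n : ℂ) - 2 / (hInv^[n] z) + n

/-- Walker's function `α_W^{(1)}`. -/
def walkerLeft (z : ℂ) : ℂ := Filter.limUnder Filter.atTop (walkerLeftSeq z)

/-- Walker's function `α_W^{(2)}`. -/
def walkerRight (z : ℂ) : ℂ := Filter.limUnder Filter.atTop (walkerRightSeq z)

/-- The truncation `v_N(z) = v_1 z + ⋯ + v_N z^N`. -/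
def truncTail (v : PowerSeries ℂ) (N : ℕ) (z : ℂ) : ℂ :=
  ∑ k ∈ Finset.Icc 1 N, PowerSeries.coeff k v * z ^ k

/-- `(1/3) log (-h^{[n]}(z)) - 2 / h^{[n]}(z) + v_N(h^{[n]}(z)) - n`. -/
def ecalleLeftSeq (v : PowerSeries ℂ) (N : ℕ) (z : ℂ) (n : ℕ) : ℂ :=
  1 / 3 * Complex.log (-(h^[n] z)) - 2 / (h^[n] z) + truncTail v N (h^[n] z) - n

/-- `(1/3) log (h^{[-n]}(z)) - 2 / h^{[-n]}(z) + v_N(h^{[-n]}(z)) + n`. -/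
def ecalleRightSeq (v : PowerSeries ℂ) (N : ℕ) (z : ℂ) (n : ℕ) : ℂ :=
  1 / 3 * Complex.log (hInv^[n] z) - 2 / (hInv^[n] z) + truncTail v N (hInv^[n] z) + n

end WalkerAbel

end

/-!
The right petal is turned into a left petal by `z ↦ -z`: both `F = h` and `F z = -log (1 - z)`,
the conjugate of the inverse branch (`hFlip`), map the left half-plane and the left petal into
themselves and have the form `F z = z + z² / 2 + (1 - ρ) / 4 · z³ + O(z⁴)`, with `ρ = 1 / 3` and
`ρ = -1 / 3`. Their orbits in the left half-plane tend to `0`, because `F` strictly decreases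
`|z|`. Everything is proved for such a map (`ParabolicMap`).

In the coordinate `w = -2 / z` the map is `w ↦ w + 1 + ρ / w + O(w⁻²)`, so `w_n ~ n` along orbits
and the increments of `w_n - ρ log w_n - n` are `O(n⁻²)`. This gives a holomorphic limit `fatou`
satisfying the Abel equation (`tendsto_fatou`, `differentiableOn_fatou`, `fatou_map`). Since
`log w_n - log n → 0`, Walker's limit is the same, and Écalle's limit differs from it by `ρ log 2`,
because `-z_n = 2 / w_n` and `v_N(z_n) → 0`.

Far to the right in the coordinate `w`, the Abel function is a translation up to a Lipschitz
error with small constant (`exists_fatou_sub_approx`, from Cauchy's estimate). Hence it is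
injective, its image contains large discs, and a first-order expansion of one orbit in terms of
another determines the difference of their Abel coordinates (`fatou_eq_add_of_isBigO`). The last
fact is the uniqueness of regular Abel functions: if `β` is regular and `β z' = β z + t`, then the
orbits of `z'` and `z` are related by the formal iterate of parameter `t` to first order, so
`z'` and `z` have Abel coordinates differing by `t`.

For the asymptotic expansion of `α⁻¹(α(z) + t)`, no expansion of `α` itself is needed. A partial
sum `p` of the formal iterate commutes with `F` up to a high order, so `α(p(z)) - α(z) - t` has
small increments along orbits and tends to `0` along them: it is small
(`exists_norm_fatou_comp_sub_le`). Inverting `α` after moving into the region where it is close to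
a translation gives `α⁻¹(α(z) + t) = p(z)` to a high order (`isBigO_sub_of_fatou_eq_add`). That
`α⁻¹(α(z) + t)` tends to `0` with `z`, even tangentially to the boundary of the petal, follows
because `Re α + |Im α|` tends to `+∞` at `0` and is bounded above on the petal away from `0`
(`norm_lt_of_fatou_eq_add`).

On the formal side, the commutation equation for the iterates and the Julia equation for the
iterative logarithm are triangular systems for the coefficients
(`exists_eq_zero_of_triangular`).
-/

noncomputable section

namespace WalkerAbel

/-! ### Formal iterates and the iterative logarithm of `e^x - 1` -/

section

open PowerSeries

/-- Modulo `X ^ N`, only the first `N` terms of `a` contribute to `a ∘ b`. -/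
theorem X_pow_dvd_subst_sub_sum (a b : PowerSeries ℂ) (hb : constantCoeff b = 0) (N : ℕ) :
    X ^ N ∣ subst b a - ∑ k ∈ Finset.range N, C (coeff k a) * b ^ k := by
  have hs : HasSubst b := HasSubst.of_constantCoeff_zero' hb
  have hX : X ∣ b := X_dvd_iff.2 hb
  rw [X_pow_dvd_iff]
  intro m hm
  have hsup : Function.support (fun d => coeff d a • coeff m (b ^ d))
      ⊆ (Finset.range N : Set ℕ) := by
    intro d hd
    by_contra hdN
    refine hd ?_
    have hNd : N ≤ d := by simpa using hdN
    have : coeff m (b ^ d) = 0 := X_pow_dvd_iff.1 (pow_dvd_pow_of_dvd hX d) m (by omega)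
    simp [this]
  rw [map_sub, coeff_subst' hs, finsum_eq_sum_of_support_subset _ hsup, map_sum]
  simp [coeff_C_mul]

/-- Triangular systems of equations for power series are solvable: if adding a term `d` of order
`≥ n` changes `Φ` by `lam n * X * d` up to order `n + 2`, with `lam n ≠ 0`, then an approximate
solution of `Φ g = 0` extends to a solution, one coefficient at a time. -/
theorem exists_eq_zero_of_triangular (Φ : PowerSeries ℂ → PowerSeries ℂ) (lam : ℕ → ℂ) (n₀ : ℕ)
    (hlam : ∀ n, n₀ ≤ n → lam n ≠ 0) (g₀ : PowerSeries ℂ) (hbase : X ^ (n₀ + 1) ∣ Φ g₀)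
    (hstep : ∀ n, n₀ ≤ n → ∀ g d, X ^ n₀ ∣ g - g₀ → X ^ n ∣ d →
      X ^ (n + 2) ∣ Φ (g + d) - Φ g - C (lam n) * X * d) :
    ∃ g, X ^ n₀ ∣ g - g₀ ∧ Φ g = 0 := by
  -- `G k` solves the equation up to order `n₀ + k`; `c k` is the next correction
  let c : ℕ → PowerSeries ℂ → ℂ := fun k g => -(coeff (n₀ + k + 1) (Φ g) / lam (n₀ + k))
  let G : ℕ → PowerSeries ℂ := fun k => Nat.rec g₀ (fun k g => g + C (c k g) * X ^ (n₀ + k)) k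
  have hG : ∀ k, G (k + 1) = G k + C (c k (G k)) * X ^ (n₀ + k) := fun k => rfl
  have hinv : ∀ k, X ^ n₀ ∣ G k - g₀ ∧ X ^ (n₀ + k + 1) ∣ Φ (G k) := by
    intro k
    induction k with
    | zero => exact ⟨by simp [G], by simpa [G] using hbase⟩
    | succ k ih =>
      have hd : X ^ (n₀ + k) ∣ C (c k (G k)) * X ^ (n₀ + k) := dvd_mul_left _ _
      constructor
      · rw [hG, add_sub_right_comm]
        exact dvd_add ih.1 ((pow_dvd_pow X (Nat.le_add_right _ _)).trans hd)
      · have h1 := hstep (n₀ + k) (Nat.le_add_right _ _) (G k) _ ih.1 hd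
        rw [← hG] at h1
        have h2 : X ^ (n₀ + k + 2) ∣
            Φ (G k) + C (lam (n₀ + k)) * X * (C (c k (G k)) * X ^ (n₀ + k)) := by
          have e : C (lam (n₀ + k)) * X * (C (c k (G k)) * X ^ (n₀ + k))
              = C (lam (n₀ + k) * c k (G k)) * X ^ (n₀ + k + 1) := by
            rw [map_mul]; ring
          rw [e, X_pow_dvd_iff]
          intro m hm
          rcases Nat.lt_succ_iff_lt_or_eq.1 hm with h | h
          · rw [map_add, X_pow_dvd_iff.1 ih.2 m h, coeff_C_mul, coeff_X_pow,
              if_neg (by omega)]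
            simp
          · subst h
            rw [map_add, coeff_C_mul, coeff_X_pow_self]
            have := hlam (n₀ + k) (Nat.le_add_right _ _)
            simp only [c]
            field_simp
            ring
        have h3 := dvd_add h1 h2
        have e : n₀ + (k + 1) + 1 = n₀ + k + 2 := by ring
        rw [e]
        convert h3 using 1
        ring
  have hstab1 : ∀ i j, i < n₀ + j → coeff i (G (j + 1)) = coeff i (G j) := by
    intro i j hij
    rw [hG, map_add, coeff_C_mul, coeff_X_pow, if_neg (by omega)]
    simp
  have hstab : ∀ i j l, i < n₀ + j → coeff i (G (j + l)) = coeff i (G j) := by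
    intro i j l hij
    induction l with
    | zero => rfl
    | succ l ih => rw [← ih, ← add_assoc, hstab1 i (j + l) (by omega)]
  let g : PowerSeries ℂ := mk fun i => coeff i (G (i + 1))
  have hg : ∀ k, X ^ (n₀ + k) ∣ g - G k := by
    intro k
    rw [X_pow_dvd_iff]
    intro m hm
    rw [map_sub, coeff_mk, sub_eq_zero]
    rcases le_total k (m + 1) with h | h
    · obtain ⟨l, hl⟩ : ∃ l, m + 1 = k + l := ⟨_, (Nat.add_sub_of_le h).symm⟩
      rw [hl, hstab m k l hm]
    · obtain ⟨l, rfl⟩ : ∃ l, k = m + 1 + l := ⟨_, (Nat.add_sub_of_le h).symm⟩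
      rw [hstab m (m + 1) l (by omega)]
  refine ⟨g, by simpa [G] using hg 0, ?_⟩
  have hk : ∀ k, X ^ (n₀ + k + 1) ∣ Φ g := by
    intro k
    have h1 := hstep (n₀ + k) (Nat.le_add_right _ _) (G k) (g - G k) (hinv k).1 (hg k)
    rw [add_sub_cancel] at h1
    have h2 : X ^ (n₀ + k + 1) ∣ C (lam (n₀ + k)) * X * (g - G k) := by
      rw [pow_succ', mul_assoc]
      exact (mul_dvd_mul_left X (hg k)).mul_left _
    have h3 := dvd_add (dvd_add ((pow_dvd_pow X (by omega)).trans h1) h2) (hinv k).2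
    convert h3 using 1
    ring
  ext m
  rw [map_zero]
  exact X_pow_dvd_iff.1 (hk m) m (by omega)

theorem constantCoeff_hSeries : constantCoeff hSeries = 0 := by
  rw [hSeries, map_sub, constantCoeff_exp, map_one, sub_self]

theorem coeff_hSeries {n : ℕ} (hn : n ≠ 0) : coeff n hSeries = 1 / (n.factorial : ℂ) := by
  simp [hSeries, coeff_exp, coeff_one, hn]

theorem coeff_two_hSeries : coeff 2 hSeries = 1 / 2 := by
  simp [coeff_hSeries]

theorem derivative_hSeries : derivative ℂ hSeries = hSeries + 1 := by
  ext n
  rw [coeff_derivative, coeff_hSeries (by omega)]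
  rw [hSeries, sub_add_cancel, coeff_exp, Nat.factorial_succ]
  push_cast
  have : ((n.factorial : ℕ) : ℂ) ≠ 0 := by exact_mod_cast n.factorial_ne_zero
  have h2 : (n + 1 : ℂ) ≠ 0 := by exact_mod_cast n.succ_ne_zero
  field_simp

theorem hSeries_expansion : ∃ r, hSeries =
    X + C (1 / 2) * X ^ 2 + C (1 / 6) * X ^ 3 + X ^ 4 * r := by
  have : X ^ 4 ∣ hSeries - (X + C (1 / 2) * X ^ 2 + C (1 / 6) * X ^ 3) := by
    rw [X_pow_dvd_iff]
    intro m hm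
    interval_cases m <;>
      simp [coeff_hSeries, coeff_X, coeff_C_mul, coeff_X_pow, Nat.factorial,
        constantCoeff_hSeries]
  obtain ⟨r, hr⟩ := this
  exact ⟨r, by rw [← hr]; ring⟩

/-- `(1 + X u) ^ n ≡ 1 + n X u` modulo `X ^ 2`. -/
theorem X_sq_dvd_one_add_pow (u : PowerSeries ℂ) (n : ℕ) :
    X ^ 2 ∣ (1 + X * u) ^ n - 1 - C (n : ℂ) * X * u := by
  induction n with
  | zero => simp
  | succ n ih =>
    obtain ⟨q, hq⟩ := ih
    refine ⟨q * (1 + X * u) + C (n : ℂ) * u ^ 2, ?_⟩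
    rw [pow_succ]
    push_cast
    rw [map_add, map_one]
    linear_combination (1 + X * u) * hq

/-- Right composition with `e^x - 1` on series of order `≥ n`, to first order. -/
theorem subst_hSeries_of_dvd (n : ℕ) (d : PowerSeries ℂ) (hd : X ^ n ∣ d) :
    X ^ (n + 2) ∣ subst hSeries d - d - C ((n : ℂ) / 2) * X * d := by
  have hs : HasSubst hSeries := HasSubst.of_constantCoeff_zero' constantCoeff_hSeries
  obtain ⟨e, rfl⟩ := hd
  rw [subst_mul hs, subst_pow hs, subst_X hs]
  obtain ⟨r, hr⟩ := hSeries_expansion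
  set u : PowerSeries ℂ := C (1 / 2) + C (1 / 6) * X + X ^ 2 * r with hu
  have hf : hSeries = X * (1 + X * u) := by rw [hr, hu]; ring
  obtain ⟨q, hq⟩ := X_sq_dvd_one_add_pow u n
  have hse : X ^ 2 ∣ subst hSeries e - e := by
    have h1 := X_pow_dvd_subst_sub_sum e hSeries constantCoeff_hSeries 2
    have h2 : X ^ 2 ∣ e - (C (coeff 0 e) + C (coeff 1 e) * X) := by
      rw [X_pow_dvd_iff]
      intro m hm
      interval_cases m <;> simp [coeff_C]
    have h3 : X ^ 2 ∣ C (coeff 1 e) * (hSeries - X) :=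
      Dvd.dvd.mul_left ⟨u, by rw [hf]; ring⟩ _
    rw [Finset.sum_range_succ, Finset.sum_range_one, pow_zero, pow_one, mul_one] at h1
    convert dvd_sub (dvd_add h1 h3) h2 using 1
    ring
  obtain ⟨p, hp⟩ := hse
  have hC : (C ((n : ℂ) / 2) : PowerSeries ℂ) = C (n : ℂ) * C (1 / 2) := by
    rw [← map_mul]; congr 1; ring
  refine ⟨(1 + X * u) ^ n * p + q * e + C (n : ℂ) * (C (1 / 6) + X * r) * e, ?_⟩
  rw [hC]
  have hpow : hSeries ^ n = X ^ n * (1 + X * u) ^ n := by rw [hf, mul_pow]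
  rw [hpow]
  have hu' : u = C (1 / 2) + X * (C (1 / 6) + X * r) := by rw [hu]; ring
  linear_combination X ^ n * (1 + X * u) ^ n * hp + X ^ n * e * hq
    + X ^ n * e * C (n : ℂ) * X * hu'

/-- Left composition with `e^x - 1`, to first order in a perturbation of order `≥ n`. -/
theorem subst_add_hSeries (n : ℕ) (hn : 2 ≤ n) (g d : PowerSeries ℂ) (hg : X ^ 2 ∣ g - X)
    (hd : X ^ n ∣ d) :
    X ^ (n + 2) ∣ subst (g + d) hSeries - subst g hSeries - d - X * d := by
  have hX2 : X ∣ d := (dvd_pow_self X (by omega)).trans hd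
  have hX1 : X ∣ g := by
    have h1 : X ∣ g - X := (dvd_pow_self X (by omega)).trans hg
    simpa using dvd_add h1 (dvd_refl X)
  have h1 := X_pow_dvd_subst_sub_sum hSeries (g + d) (X_dvd_iff.1 (dvd_add hX1 hX2)) (n + 2)
  have h2 := X_pow_dvd_subst_sub_sum hSeries g (X_dvd_iff.1 hX1) (n + 2)
  have h3 : X ^ (n + 2) ∣ ∑ k ∈ Finset.range (n + 2), C (coeff k hSeries) * (g + d) ^ k
      - ∑ k ∈ Finset.range (n + 2), C (coeff k hSeries) * g ^ k - d - X * d := by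
    have hsplit : ∀ y : PowerSeries ℂ, ∑ k ∈ Finset.range (n + 2), C (coeff k hSeries) * y ^ k
        = ∑ k ∈ Finset.range (n - 1), C (coeff (k + 3) hSeries) * y ^ (k + 3)
          + (y + C (1 / 2) * y ^ 2) := by
      intro y
      have e : n + 2 = (n - 1) + 3 := by omega
      rw [e, Finset.sum_range_succ', Finset.sum_range_succ', Finset.sum_range_succ']
      simp [coeff_hSeries, constantCoeff_hSeries]
      ring
    rw [hsplit, hsplit]
    have h4 : X ^ (n + 2) ∣ ∑ k ∈ Finset.range (n - 1), C (coeff (k + 3) hSeries)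
        * ((g + d) ^ (k + 3) - g ^ (k + 3)) := by
      refine Finset.dvd_sum fun k _ => Dvd.dvd.mul_left ?_ _
      obtain ⟨g₁, rfl⟩ := hX1
      obtain ⟨e, rfl⟩ := hd
      obtain ⟨m, rfl⟩ : ∃ m, n = m + 1 := ⟨n - 1, by omega⟩
      have e1 : (X * g₁ + X ^ (m + 1) * e) = X * (g₁ + X ^ m * e) := by ring
      have h5 : X ^ m ∣ (g₁ + X ^ m * e) ^ (k + 3) - g₁ ^ (k + 3) :=
        (Dvd.intro e (by ring)).trans (sub_dvd_pow_sub_pow _ _ _)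
      rw [e1, mul_pow, mul_pow, ← mul_sub]
      have e2 : m + 1 + 2 = 3 + m := by ring
      rw [e2, pow_add]
      exact mul_dvd_mul (pow_dvd_pow X (by omega)) h5
    obtain ⟨w, hw⟩ := hg
    obtain ⟨e, he⟩ := hd
    have h6 : X ^ (n + 2) ∣ d + C (1 / 2) * ((g + d) ^ 2 - g ^ 2) - d - X * d := by
      obtain ⟨m, rfl⟩ : ∃ m, n = m + 2 := ⟨n - 2, by omega⟩
      refine ⟨w * e + C (1 / 2) * X ^ m * e ^ 2, ?_⟩
      have hg' : g = X + X ^ 2 * w := by rw [← hw]; ring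
      have hC : (C (1 / 2) : PowerSeries ℂ) * 2 = 1 := by
        rw [← map_ofNat (C (R := ℂ)) 2, ← map_mul, ← map_one (C (R := ℂ))]; norm_num
      rw [he, hg']
      linear_combination ((X + X ^ 2 * w) * (X ^ (m + 2) * e)) * hC
    convert dvd_add h4 h6 using 1
    simp only [mul_sub, Finset.sum_sub_distrib]
    ring
  convert dvd_add (dvd_sub h1 h2) h3 using 1
  ring

/-- The formal regular iterates of `e^x - 1` exist. -/
theorem exists_isFormalIterate (t : ℂ) : ∃ g, IsFormalIterate hSeries 2 t g := by
  have hs : HasSubst hSeries := HasSubst.of_constantCoeff_zero' constantCoeff_hSeries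
  obtain ⟨r, hr⟩ := hSeries_expansion
  set g₀ : PowerSeries ℂ := X + C (t / 2) * X ^ 2 with hg₀
  obtain ⟨g, hg, hΦ⟩ := exists_eq_zero_of_triangular
    (fun g => subst hSeries g - subst g hSeries) (fun n => ((n : ℂ) - 2) / 2) 3
    (fun n hn => by
      have : (n : ℂ) - 2 ≠ 0 := by
        rw [sub_ne_zero]; exact_mod_cast (by omega : n ≠ 2)
      exact div_ne_zero this two_ne_zero) g₀ (by
      have hg0 : constantCoeff g₀ = 0 := by simp [hg₀]
      have h1 := X_pow_dvd_subst_sub_sum hSeries g₀ hg0 4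
      have h2 : subst hSeries g₀ = hSeries + C (t / 2) * hSeries ^ 2 := by
        have hC : (C (t / 2) : PowerSeries ℂ) * X ^ 2 = (t / 2) • X ^ 2 := by
          rw [smul_eq_C_mul]
        rw [hg₀, hC, subst_add hs, subst_smul hs, subst_pow hs, subst_X hs, smul_eq_C_mul]
      have h3 : ∑ k ∈ Finset.range 4, C (coeff k hSeries) * g₀ ^ k
          = g₀ + C (1 / 2) * g₀ ^ 2 + C (1 / 6) * g₀ ^ 3 := by
        simp [Finset.sum_range_succ, coeff_hSeries, constantCoeff_hSeries, Nat.factorial]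
      rw [h3] at h1
      have h4 : X ^ 4 ∣ subst hSeries g₀ - (g₀ + C (1 / 2) * g₀ ^ 2 + C (1 / 6) * g₀ ^ 3) := by
        rw [h2, hg₀, hr]
        generalize (C (t / 2) : PowerSeries ℂ) = s at *
        generalize (C (1 / 2) : PowerSeries ℂ) = a at *
        generalize (C (1 / 6) : PowerSeries ℂ) = b at *
        refine ⟨r + s * (a ^ 2 + 2 * b + 2 * X * r + 2 * a * b * X + X ^ 2 * b ^ 2
          + 2 * a * X ^ 2 * r + 2 * b * X ^ 3 * r + X ^ 4 * r ^ 2)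
          - a * s ^ 2 - b * (3 * s + 3 * s ^ 2 * X + s ^ 3 * X ^ 2), ?_⟩
        ring
      convert dvd_sub h4 h1 using 1
      ring)
    (fun n hn g d hg hd => by
      have hg2 : X ^ 2 ∣ g - X := by
        have h1 : X ^ 2 ∣ g - g₀ := (pow_dvd_pow X (by omega)).trans hg
        convert dvd_add h1 (Dvd.intro_left (C (t / 2)) rfl) using 1
        rw [hg₀]; ring
      have h1 := subst_hSeries_of_dvd n d hd
      have h2 := subst_add_hSeries n (by omega) g d hg2 hd
      convert dvd_sub h1 h2 using 1
      have hC : (C (((n : ℂ) - 2) / 2) : PowerSeries ℂ) = C ((n : ℂ) / 2) - 1 := by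
        rw [← map_one (C (R := ℂ)), ← map_sub]; congr 1; ring
      simp only [hC, subst_add hs]
      ring)
  have hc : ∀ m, m < 3 → coeff m g = coeff m g₀ := fun m hm => by
    rw [← sub_eq_zero, ← map_sub]; exact X_pow_dvd_iff.1 hg m hm
  refine ⟨g, ⟨?_, ?_, fun n h1 h2 => by omega, ?_, sub_eq_zero.1 hΦ⟩⟩
  · rw [hc 0 (by omega)]; simp [hg₀]
  · rw [hc 1 (by omega)]; simp [hg₀, coeff_C_mul, coeff_X_pow]
  · rw [hc 2 (by omega), coeff_two_hSeries]
    simp [hg₀, coeff_C_mul, coeff_X]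
    ring

/-- The iterative logarithm of `e^x - 1` exists, and it starts with `x² / 2 - x³ / 12`. -/
theorem exists_isIterativeLog : ∃ j, IsIterativeLog hSeries 2 j ∧
    X ^ 4 ∣ j - (C (1 / 2) * X ^ 2 - C (1 / 12) * X ^ 3) := by
  have hs : HasSubst hSeries := HasSubst.of_constantCoeff_zero' constantCoeff_hSeries
  obtain ⟨r, hr⟩ := hSeries_expansion
  set g₀ : PowerSeries ℂ := C (1 / 2) * X ^ 2 - C (1 / 12) * X ^ 3 with hg₀
  obtain ⟨g, hg, hΦ⟩ := exists_eq_zero_of_triangular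
    (fun g => subst hSeries g - derivative ℂ hSeries * g) (fun n => ((n : ℂ) - 2) / 2) 4
    (fun n hn => by
      have : (n : ℂ) - 2 ≠ 0 := by
        rw [sub_ne_zero]; exact_mod_cast (by omega : n ≠ 2)
      exact div_ne_zero this two_ne_zero) g₀ (by
      have h2 : subst hSeries g₀ = C (1 / 2) * hSeries ^ 2 - C (1 / 12) * hSeries ^ 3 := by
        rw [hg₀, ← smul_eq_C_mul, ← smul_eq_C_mul, subst_sub hs, subst_smul hs, subst_smul hs,
          subst_pow hs, subst_pow hs, subst_X hs, smul_eq_C_mul, smul_eq_C_mul]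
      have hC2 : (C (1 / 2) : PowerSeries ℂ) = 6 * C (1 / 12) := by
        rw [← map_ofNat (C (R := ℂ)) 6, ← map_mul]; norm_num
      have hC6 : (C (1 / 6) : PowerSeries ℂ) = 2 * C (1 / 12) := by
        rw [← map_ofNat (C (R := ℂ)) 2, ← map_mul]; norm_num
      have hC12 : (C (1 / 12) : PowerSeries ℂ) * 12 = 1 := by
        rw [← map_ofNat (C (R := ℂ)) 12, ← map_mul, ← map_one (C (R := ℂ))]; norm_num
      rw [h2, derivative_hSeries, hg₀, hr, hC2, hC6]
      clear hC2 hC6 hg₀ h2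
      generalize (C (1 / 12) : PowerSeries ℂ) = a at *
      -- the explicit quotient by `X ^ 5`, with `a = 1 / 12` and `r` the tail of the series
      refine ⟨12 * a * r - 12 * a ^ 2 + 36 * a ^ 3 - 9 * X * a * r + 2 * X * a ^ 2 +
        72 * X * a ^ 2 * r - 48 * X * a ^ 3 - 216 * X * a ^ 4 + X ^ 2 * a * r -
        12 * X ^ 2 * a ^ 2 * r - 12 * X ^ 2 * a ^ 3 - 216 * X ^ 2 * a ^ 4 +
        6 * X ^ 3 * a * r ^ 2 - 12 * X ^ 3 * a ^ 2 * r - 108 * X ^ 3 * a ^ 3 * r -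
        72 * X ^ 3 * a ^ 4 - 3 * X ^ 4 * a * r ^ 2 - 72 * X ^ 4 * a ^ 3 * r - 8 * X ^ 4 * a ^ 4
        - 18 * X ^ 5 * a ^ 2 * r ^ 2 - 12 * X ^ 5 * a ^ 3 * r - 6 * X ^ 6 * a ^ 2 * r ^ 2 -
        X ^ 7 * a * r ^ 3, ?_⟩
      linear_combination (6 * X ^ 3 * a + X ^ 4 * a * (18 * a - 1)) * hC12)
    (fun n hn g d hg hd => by
      have h1 := subst_hSeries_of_dvd n d hd
      have h2 : X ^ (n + 2) ∣ (hSeries - X) * d := by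
        rw [add_comm, pow_add]
        exact mul_dvd_mul ⟨C (1 / 2) + C (1 / 6) * X + X ^ 2 * r, by rw [hr]; ring⟩ hd
      convert dvd_sub h1 h2 using 1
      have hC : (C (((n : ℂ) - 2) / 2) : PowerSeries ℂ) = C ((n : ℂ) / 2) - 1 := by
        rw [← map_one (C (R := ℂ)), ← map_sub]; congr 1; ring
      simp only [hC, subst_add hs, derivative_hSeries]
      ring)
  have hc : ∀ m, m < 4 → coeff m g = coeff m g₀ := fun m hm => by
    rw [← sub_eq_zero, ← map_sub]; exact X_pow_dvd_iff.1 hg m hm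
  refine ⟨g, ⟨fun n hn => ?_, ?_, sub_eq_zero.1 hΦ⟩, hg⟩
  · rw [hc n (by omega)]
    interval_cases n <;> simp [hg₀, coeff_C_mul, coeff_X_pow]
  · rw [hc 2 (by omega), coeff_two_hSeries]
    simp [hg₀, coeff_C_mul, coeff_X_pow]

/-- The tail `v` of the formal Abel function exists: the coefficient `-1 / 12` of the iterative
logarithm gives the residue `1 / 3` of `1 / j`, and what remains of `1 / j` is a power series,
which is integrated termwise. -/
theorem exists_isAbelTail : ∃ v, IsAbelTail v := by
  obtain ⟨j, hj, e, he⟩ := exists_isIterativeLog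
  -- `1 / j = u⁻¹ / x²` with `u⁻¹ = 2 + x / 3 + O(x²)`
  set u : PowerSeries ℂ := C (1 / 2) - C (1 / 12) * X + X ^ 2 * e with hu
  have hju : j = X ^ 2 * u := by rw [hu]; linear_combination he
  have hcu : constantCoeff u ≠ 0 := by simp [hu]
  have hinv : u⁻¹ * u = 1 := PowerSeries.inv_mul_cancel _ hcu
  have hq : X ^ 2 ∣ u⁻¹ - (C 2 + C (1 / 3) * X) := by
    have h12 : (C (1 / 12) : PowerSeries ℂ) * 12 = 1 := by
      rw [← map_ofNat (C (R := ℂ)) 12, ← map_mul, ← map_one (C (R := ℂ))]; norm_num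
    have h2 : (C (1 / 2) : PowerSeries ℂ) = 6 * C (1 / 12) := by
      rw [← map_ofNat (C (R := ℂ)) 6, ← map_mul]; norm_num
    have h3 : (C (1 / 3) : PowerSeries ℂ) = 4 * C (1 / 12) := by
      rw [← map_ofNat (C (R := ℂ)) 4, ← map_mul]; norm_num
    rw [map_ofNat, h3]
    rw [h2] at hu
    clear_value u
    generalize (C (1 / 12) : PowerSeries ℂ) = a at *
    refine ⟨u⁻¹ * (4 * a ^ 2 - (2 + 4 * a * X) * e), ?_⟩
    linear_combination (2 + 4 * a * X) * hinv - (2 + 4 * a * X) * u⁻¹ * hu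
      - u⁻¹ * (1 + 2 * a * X) * h12
  obtain ⟨q, hq⟩ := hq
  refine ⟨mk fun n => if n = 0 then 0 else coeff (n - 1) q / n, by simp, j, hj, ?_⟩
  have hd : derivative ℂ (mk fun n => if n = 0 then 0 else coeff (n - 1) q / (n : ℂ)) = q := by
    ext n
    rw [coeff_derivative, coeff_mk, if_neg n.succ_ne_zero, Nat.add_sub_cancel]
    have h2 : (n + 1 : ℂ) ≠ 0 := by exact_mod_cast n.succ_ne_zero
    push_cast
    field_simp
  rw [hd, ← hq, hju]
  linear_combination X ^ 2 * hinv

end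

/-! ### Parabolic maps in the coordinate `w = -2 / z` -/

section

open Filter Topology Asymptotics

/-- The coordinate `w = -2 / z`, in which a parabolic map `z + z² / 2 + ⋯` is close to the
translation `w ↦ w + 1` near `w = ∞`. -/
def wc (z : ℂ) : ℂ := -2 / z

theorem wc_wc (z : ℂ) : wc (wc z) = z := by
  rcases eq_or_ne z 0 with rfl | h
  · simp [wc]
  · simp only [wc]; field_simp

theorem norm_wc (z : ℂ) : ‖wc z‖ = 2 / ‖z‖ := by simp [wc]

theorem norm_eq_div_norm_wc (z : ℂ) : ‖z‖ = 2 / ‖wc z‖ := by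
  conv_lhs => rw [← wc_wc z, norm_wc]

theorem wc_re (z : ℂ) : (wc z).re = -2 * z.re / Complex.normSq z := by
  simp [wc, Complex.div_re]

theorem wc_re_pos {z : ℂ} : 0 < (wc z).re ↔ z.re < 0 := by
  rw [wc_re]
  rcases eq_or_ne z 0 with rfl | h
  · simp
  · rw [lt_div_iff₀ (Complex.normSq_pos.2 h)]
    constructor <;> intro h <;> linarith

theorem ne_zero_of_re_neg {z : ℂ} (hz : z.re < 0) : z ≠ 0 := by
  rintro rfl; simp at hz

theorem ne_zero_of_re_pos {z : ℂ} (hz : 0 < z.re) : z ≠ 0 := by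
  rintro rfl; simp at hz

theorem wc_ne_zero {z : ℂ} (hz : z.re < 0) : wc z ≠ 0 := ne_zero_of_re_pos (wc_re_pos.2 hz)

theorem norm_wc_sub_wc {x y : ℂ} (hx : x ≠ 0) (hy : y ≠ 0) :
    ‖x - y‖ * (‖wc x‖ * ‖wc y‖) = 2 * ‖wc x - wc y‖ := by
  have : (x - y) * (wc x * wc y) = 2 * (wc x - wc y) := by
    simp only [wc]; field_simp; ring_nf
  rw [← norm_mul, ← norm_mul, this, norm_mul]; simp

theorem isOpen_re_neg : IsOpen {z : ℂ | z.re < 0} :=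
  isOpen_lt Complex.continuous_re continuous_const

/-- A holomorphic self-map of the left half-plane and of the left petal with a parabolic fixed
point at `0`, `F z = z + z² / 2 + (1 - ρ) / 4 · z³ + O(z⁴)`, all of whose orbits in the left
half-plane tend to `0`. The normalization of the cubic coefficient is such that `F` is
`w ↦ w + 1 + ρ / w + O(w⁻²)` in the coordinate `w = -2 / z`. -/
structure ParabolicMap (F : ℂ → ℂ) (ρ : ℂ) : Prop where
  mapsTo : ∀ z : ℂ, z.re < 0 → (F z).re < 0
  mapsTo_petal : ∀ z ∈ leftPetal, F z ∈ leftPetal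
  differentiableOn : DifferentiableOn ℂ F {z : ℂ | z.re < 0}
  injOn : Set.InjOn F leftPetal
  push : ∀ ε : ℝ, 0 < ε → ∃ c : ℝ, 0 < c ∧ ∀ z ∈ leftPetal, ε ≤ ‖z‖ → (F z).re ≤ -c
  tendsto_zero : ∀ z : ℂ, z.re < 0 → Tendsto (fun n => F^[n] z) atTop (𝓝 0)
  expansion : (fun z => F z - z - z ^ 2 / 2 - (1 - ρ) / 4 * z ^ 3) =O[𝓝 0] (fun z : ℂ => z ^ 4)
  strict : HasStrictDerivAt F 1 0
  map_zero : F 0 = 0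

theorem isBigO_pow_of_le {ι : Type*} {l : Filter ι} {x : ι → ℂ} (hx : Tendsto x l (𝓝 0))
    {m n : ℕ} (hmn : m ≤ n) : (fun i => x i ^ n) =O[l] (fun i => x i ^ m) := by
  obtain ⟨k, rfl⟩ := Nat.exists_eq_add_of_le hmn
  simp only [pow_add]
  simpa using (isBigO_refl (fun i => x i ^ m) l).mul ((hx.pow k).isBigO_one ℂ)

/-- If `y = x + (s / 2) x² + O(x³)` as `x → 0`, then `-2 / y = -2 / x + s + o(1)`. -/
theorem tendsto_wc_sub_wc {ι : Type*} {l : Filter ι} {x y : ι → ℂ} {s : ℂ}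
    (hx : Tendsto x l (𝓝 0)) (hx0 : ∀ᶠ i in l, x i ≠ 0)
    (hxy : (fun i => y i - x i - s / 2 * x i ^ 2) =O[l] (fun i => x i ^ 3)) :
    Tendsto (fun i => wc (y i) - wc (x i)) l (𝓝 s) := by
  have h2 : (fun i => y i - x i) =O[l] (fun i => x i ^ 2) := by
    have := (hxy.trans (isBigO_pow_of_le hx (by norm_num : 2 ≤ 3))).add
      ((isBigO_refl (fun i => x i ^ 2) l).const_mul_left (s / 2))
    simpa using this
  have h1 : (fun i => y i - x i) =o[l] x := by
    refine h2.trans_isLittleO ?_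
    have := (isBigO_refl x l).mul_isLittleO ((isLittleO_one_iff ℂ).2 hx)
    simpa [sq] using this
  have hyx : (fun i => x i) =O[l] y := by
    have : y ~[l] x := h1
    exact this.symm.isBigO
  have hy0 : ∀ᶠ i in l, y i ≠ 0 := by
    have := hyx.eq_zero_imp
    filter_upwards [this, hx0] with i h h' hy using h' (h hy)
  have hN : (fun i => 2 * (y i - x i - s / 2 * x i ^ 2) - s * x i * (y i - x i))
      =O[l] (fun i => x i ^ 3) := by
    refine (hxy.const_mul_left 2).sub ?_
    have := ((isBigO_refl x l).const_mul_left s).mul h2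
    refine this.congr_right fun i => by ring
  have hD : (fun i => (x i * y i)⁻¹) =O[l] (fun i => (x i ^ 2)⁻¹) := by
    refine IsBigO.inv_rev ?_ ?_
    · simpa [sq] using (isBigO_refl x l).mul hyx
    · filter_upwards [hx0] with i h h'
      simp [h] at h'
  have hq := hN.mul hD
  have hfin : (fun i => wc (y i) - wc (x i) - s) =O[l] x := by
    refine hq.congr' ?_ ?_
    · filter_upwards [hx0, hy0] with i h h'
      simp only [wc]; field_simp; ring
    · filter_upwards [hx0] with i h
      field_simp
  have := hfin.trans_tendsto hx
  simpa using this.add_const s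

/-- Quantitative form of `w ↦ w + 1 + ρ / w + O(w⁻²)` on the part `‖w‖ ≥ R` of the right
half-plane of the coordinate `w`. -/
structure StepBound (F : ℂ → ℂ) (ρ : ℂ) (R C : ℝ) : Prop where
  four_le : 4 ≤ R
  nonneg : 0 ≤ C
  bound : ∀ z : ℂ, z.re < 0 → R ≤ ‖wc z‖ →
    ‖wc (F z) - wc z - 1 - ρ / wc z‖ ≤ C / ‖wc z‖ ^ 2
  step : ∀ z : ℂ, z.re < 0 → R ≤ ‖wc z‖ → ‖wc (F z) - wc z - 1‖ ≤ 1 / 4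

namespace ParabolicMap
variable {F : ℂ → ℂ} {ρ : ℂ}

theorem exists_stepBound (hF : ParabolicMap F ρ) : ∃ R C, StepBound F ρ R C := by
  have hFz : (fun z : ℂ => z) =O[𝓝 0] F := by
    have h1 : Tendsto (fun z : ℂ => (z, (0 : ℂ))) (𝓝 0) (𝓝 (0, 0)) :=
      Continuous.tendsto' (by fun_prop) _ _ rfl
    have h2 := (hF.strict.isTheta_sub one_ne_zero).isBigO_symm.comp_tendsto h1
    simpa [Function.comp_def, hF.map_zero] using h2
  set E : ℂ → ℂ := fun z => F z - z - z ^ 2 / 2 - (1 - ρ) / 4 * z ^ 3 with hE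
  have hN : (fun z : ℂ => (2 - z + ρ * z ^ 2 / 2) * E z
      + z ^ 4 * (-((1 - ρ) / 4) + ρ / 4 + ρ * ((1 - ρ) / 4) * z / 2)) =O[𝓝 0]
      (fun z : ℂ => z ^ 4) := by
    have b1 : (fun z : ℂ => 2 - z + ρ * z ^ 2 / 2) =O[𝓝 0] (fun _ => (1 : ℂ)) :=
      (Continuous.tendsto (by fun_prop) 0).isBigO_one ℂ
    have b2 : (fun z : ℂ => -((1 - ρ) / 4) + ρ / 4 + ρ * ((1 - ρ) / 4) * z / 2)
        =O[𝓝 0] (fun _ => (1 : ℂ)) :=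
      (Continuous.tendsto (by fun_prop) 0).isBigO_one ℂ
    have h1 := b1.mul hF.expansion
    have h2 := (isBigO_refl (fun z : ℂ => z ^ 4) (𝓝 0)).mul b2
    simpa using (h1.congr_right (by simp)).add (h2.congr_right (by simp))
  have hD : (fun z : ℂ => (z * F z)⁻¹) =O[𝓝[≠] 0] (fun z => (z ^ 2)⁻¹) := by
    refine IsBigO.inv_rev ?_ ?_
    · simpa [sq] using ((isBigO_refl (fun z : ℂ => z) (𝓝 0)).mul hFz).mono nhdsWithin_le_nhds
    · filter_upwards [self_mem_nhdsWithin] with z h h'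
      simp at h h'; exact absurd h' h
  have hF0 : ∀ᶠ z in 𝓝[≠] (0 : ℂ), F z ≠ 0 := by
    filter_upwards [(hFz.mono nhdsWithin_le_nhds).eq_zero_imp, self_mem_nhdsWithin] with z h h' hy
      using h' (h hy)
  have hfin : (fun z => wc (F z) - wc z - 1 - ρ / wc z) =O[𝓝[≠] 0] (fun z : ℂ => z ^ 2) := by
    refine ((hN.mono nhdsWithin_le_nhds).mul hD).congr' ?_ ?_
    · filter_upwards [hF0, self_mem_nhdsWithin] with z h h'
      have h' : z ≠ 0 := h'
      simp only [wc, hE]; field_simp; ring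
    · filter_upwards [self_mem_nhdsWithin] with z h'
      have h' : z ≠ 0 := h'
      field_simp
  obtain ⟨C, hC0, hC⟩ := hfin.exists_pos
  have hC := hC.bound
  obtain ⟨r, hr, hrC⟩ := Metric.mem_nhdsWithin_iff.1 hC
  refine ⟨max (max 4 (3 / r)) (8 * (‖ρ‖ + C)), C * 4, ?_⟩
  have key : ∀ z : ℂ, z.re < 0 → max (max 4 (3 / r)) (8 * (‖ρ‖ + C)) ≤ ‖wc z‖ →
      ‖wc (F z) - wc z - 1 - ρ / wc z‖ ≤ C * 4 / ‖wc z‖ ^ 2 := by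
    intro z hz hR
    have hz0 := ne_zero_of_re_neg hz
    have h3 : 3 / r ≤ ‖wc z‖ := ((le_max_right _ _).trans (le_max_left _ _)).trans hR
    have hzr : ‖z‖ < r := by
      rw [norm_eq_div_norm_wc]
      have : 0 < ‖wc z‖ := lt_of_lt_of_le (by positivity) h3
      rw [div_lt_iff₀ this]
      rw [div_le_iff₀ hr] at h3
      linarith
    have := hrC ⟨by simpa using hzr, hz0⟩
    simp only [Set.mem_ofPred_eq] at this
    refine this.trans (le_of_eq ?_)
    rw [norm_pow, norm_eq_div_norm_wc z, div_pow]
    ring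
  refine ⟨(le_max_left _ _).trans (le_max_left _ _), by positivity, key, fun z hz hR => ?_⟩
  have h4 : 4 ≤ ‖wc z‖ := ((le_max_left _ _).trans (le_max_left _ _)).trans hR
  have h8 : 8 * (‖ρ‖ + C) ≤ ‖wc z‖ := (le_max_right _ _).trans hR
  have h1 := key z hz hR
  have h2 : ‖ρ / wc z‖ = ‖ρ‖ / ‖wc z‖ := norm_div _ _
  have hw : 0 < ‖wc z‖ := by linarith
  have h5 : C * 4 / ‖wc z‖ ^ 2 ≤ C / ‖wc z‖ := by
    rw [div_le_div_iff₀ (by positivity) hw]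
    nlinarith [mul_nonneg hC0.le (mul_nonneg hw.le (sub_nonneg.2 h4))]
  have h6 : C / ‖wc z‖ + ‖ρ‖ / ‖wc z‖ ≤ 1 / 8 := by
    rw [← add_div, div_le_iff₀ hw]; linarith
  calc ‖wc (F z) - wc z - 1‖ = ‖(wc (F z) - wc z - 1 - ρ / wc z) + ρ / wc z‖ := by
        rw [sub_add_cancel]
    _ ≤ _ := norm_add_le _ _
    _ ≤ 1 / 4 := by linarith

theorem iterate_re_neg (hF : ParabolicMap F ρ) {z : ℂ} (hz : z.re < 0) (n : ℕ) :
    (F^[n] z).re < 0 := by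
  induction n with
  | zero => exact hz
  | succ n ih => rw [Function.iterate_succ_apply']; exact hF.mapsTo _ ih

theorem iterate_mem_petal (hF : ParabolicMap F ρ) {z : ℂ} (hz : z ∈ leftPetal) (n : ℕ) :
    F^[n] z ∈ leftPetal := by
  induction n with
  | zero => exact hz
  | succ n ih => rw [Function.iterate_succ_apply']; exact hF.mapsTo_petal _ ih

theorem differentiableOn_iterate (hF : ParabolicMap F ρ) (n : ℕ) :
    DifferentiableOn ℂ F^[n] {z : ℂ | z.re < 0} := by
  induction n with
  | zero => exact differentiableOn_id
  | succ n ih =>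
    rw [Function.iterate_succ']
    exact hF.differentiableOn.comp ih fun z hz => hF.iterate_re_neg hz n

end ParabolicMap

namespace StepBound
variable {F : ℂ → ℂ} {ρ : ℂ} {R C : ℝ}

/-- Orbits starting at `‖w‖ ≥ 2 R` move to the right at speed at least `3 / 4`, with vertical
drift at most `1 / 4` per step. -/
theorem orbit (hB : StepBound F ρ R C) (hF : ParabolicMap F ρ) {z : ℂ} (hz : z.re < 0)
    (hzR : 2 * R ≤ ‖wc z‖) (k : ℕ) :
    (wc z).re + 3 / 4 * k ≤ (wc (F^[k] z)).re ∧
      |(wc (F^[k] z)).im - (wc z).im| ≤ 1 / 4 * k ∧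
      ‖wc z‖ / 2 + k / 4 ≤ ‖wc (F^[k] z)‖ := by
  have h4 := hB.four_le
  have key : ∀ w : ℂ, (wc z).re + 3 / 4 * k ≤ w.re → |w.im - (wc z).im| ≤ 1 / 4 * k →
      ‖wc z‖ / 2 + k / 4 ≤ ‖w‖ := by
    intro w h1 h2
    have h3 : w.re ≤ ‖w‖ := Complex.re_le_norm w
    have h5 : |w.im| ≤ ‖w‖ := Complex.abs_im_le_norm w
    have h6 : ‖wc z‖ ≤ |(wc z).re| + |(wc z).im| := Complex.norm_le_abs_re_add_abs_im _
    rw [abs_of_pos (wc_re_pos.2 hz)] at h6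
    have h7 : |(wc z).im| ≤ |w.im| + |w.im - (wc z).im| := by
      have := abs_sub_abs_le_abs_sub (wc z).im w.im
      rw [abs_sub_comm] at this
      linarith
    linarith
  suffices h : (wc z).re + 3 / 4 * k ≤ (wc (F^[k] z)).re ∧
      |(wc (F^[k] z)).im - (wc z).im| ≤ 1 / 4 * k from ⟨h.1, h.2, key _ h.1 h.2⟩
  clear key
  induction k with
  | zero => simp
  | succ k ih =>
    have h3 : (wc (F^[k] z)).re ≤ ‖wc (F^[k] z)‖ := Complex.re_le_norm _
    have h5 : |(wc (F^[k] z)).im| ≤ ‖wc (F^[k] z)‖ := Complex.abs_im_le_norm _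
    have h6 : ‖wc z‖ ≤ |(wc z).re| + |(wc z).im| := Complex.norm_le_abs_re_add_abs_im _
    rw [abs_of_pos (wc_re_pos.2 hz)] at h6
    have h7 : |(wc z).im| ≤ |(wc (F^[k] z)).im| + |(wc (F^[k] z)).im - (wc z).im| := by
      have := abs_sub_abs_le_abs_sub (wc z).im (wc (F^[k] z)).im
      rw [abs_sub_comm] at this
      linarith
    have hk : (0 : ℝ) ≤ k := k.cast_nonneg
    have hs := hB.step (F^[k] z) (hF.iterate_re_neg hz k) (by linarith [ih.1, ih.2])
    rw [← Function.iterate_succ_apply' F k z] at hs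
    have hre := (Complex.abs_re_le_norm _).trans hs
    have him := (Complex.abs_im_le_norm _).trans hs
    simp only [Complex.sub_re, Complex.sub_im, Complex.one_re, Complex.one_im, sub_zero]
      at hre him
    rw [abs_le] at hre him
    have i2 := ih.2
    rw [abs_le] at i2 ⊢
    push_cast
    refine ⟨by linarith [ih.1], by linarith, by linarith⟩

end StepBound

/-- On the right half-plane, logarithms subtract without crossing the branch cut. -/
theorem log_sub_log_of_re_pos {w v : ℂ} (hw : 0 < w.re) (hv : 0 < v.re) :
    Complex.log v - Complex.log w = Complex.log (1 + (v - w) / w) := by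
  have hw0 := ne_zero_of_re_pos hw
  have hv0 := ne_zero_of_re_pos hv
  have e : 1 + (v - w) / w = v / w := by field_simp; ring
  have a1 := abs_lt.1 (Complex.abs_arg_lt_pi_div_two_iff.2 (Or.inl hw))
  have a2 := abs_lt.1 (Complex.abs_arg_lt_pi_div_two_iff.2 (Or.inl hv))
  have hinv : w⁻¹.arg = -w.arg := by
    rw [Complex.arg_inv, if_neg]
    intro h; rw [h] at a1; linarith [Real.pi_pos]
  rw [e, div_eq_mul_inv, Complex.log_mul hv0 (inv_ne_zero hw0), Complex.log_inv]
  · ring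
  · intro h; rw [h] at a1; linarith [Real.pi_pos]
  · rw [hinv]
    constructor <;> linarith

/-- The approximants `w_n - ρ log w_n - n` of the Abel function, where `w_n = -2 / F^n(z)`. -/
def fatouSeq (F : ℂ → ℂ) (ρ z : ℂ) (n : ℕ) : ℂ :=
  wc (F^[n] z) - ρ * Complex.log (wc (F^[n] z)) - n

/-- The Abel function (attracting Fatou coordinate) of a parabolic map. -/
def fatou (F : ℂ → ℂ) (ρ z : ℂ) : ℂ := limUnder atTop (fatouSeq F ρ z)

theorem StepBound.norm_fatouSeq_succ_sub {F : ℂ → ℂ} {ρ : ℂ} {R C : ℝ} (hB : StepBound F ρ R C)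
    (hF : ParabolicMap F ρ) {z : ℂ} (hz : z.re < 0) (k : ℕ) (hk : R ≤ ‖wc (F^[k] z)‖) :
    ‖fatouSeq F ρ z (k + 1) - fatouSeq F ρ z k‖ ≤
      (C + ‖ρ‖ * (2 + ‖ρ‖ + C)) / ‖wc (F^[k] z)‖ ^ 2 := by
  have hy := hF.iterate_re_neg hz k
  have hy' := hF.iterate_re_neg hz (k + 1)
  unfold fatouSeq
  rw [Function.iterate_succ_apply'] at *
  set y := F^[k] z
  have hw := wc_re_pos.2 hy
  have hv := wc_re_pos.2 hy'
  have hb := hB.bound y hy hk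
  have hs := hB.step y hy hk
  have h4 := hB.four_le.trans hk
  have hC := hB.nonneg
  have hl := log_sub_log_of_re_pos hw hv
  set w := wc y
  set v := wc (F y)
  have hw0 : w ≠ 0 := ne_zero_of_re_pos hw
  have hwp : 0 < ‖w‖ := by linarith
  set x := (v - w) / w with hx
  have hvw : ‖v - w‖ ≤ 5 / 4 := by
    calc ‖v - w‖ = ‖(v - w - 1) + 1‖ := by rw [sub_add_cancel]
      _ ≤ ‖v - w - 1‖ + ‖(1 : ℂ)‖ := norm_add_le _ _
      _ ≤ 5 / 4 := by rw [norm_one]; linarith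
  have hxn : ‖x‖ ≤ 5 / 4 / ‖w‖ := by rw [hx, norm_div]; gcongr
  have hx2 : ‖x‖ ≤ 5 / 16 := hxn.trans (by rw [div_le_iff₀ hwp]; linarith)
  have hlog : ‖Complex.log (1 + x) - x‖ ≤ 2 / ‖w‖ ^ 2 := by
    refine (Complex.norm_log_one_add_sub_self_le (by linarith)).trans ?_
    have h1 : (1 - ‖x‖)⁻¹ ≤ 2 := by
      rw [inv_le_comm₀ (by linarith) (by norm_num)]; norm_num; linarith
    have h0 : 0 ≤ (1 - ‖x‖)⁻¹ := inv_nonneg.2 (by linarith)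
    calc ‖x‖ ^ 2 * (1 - ‖x‖)⁻¹ / 2 ≤ (5 / 4 / ‖w‖) ^ 2 * 2 / 2 := by gcongr
      _ ≤ 2 / ‖w‖ ^ 2 := by
        rw [div_pow, mul_div_assoc, div_self two_ne_zero, mul_one]
        gcongr; norm_num
  have hxw : ‖x - 1 / w‖ ≤ (‖ρ‖ + C) / ‖w‖ ^ 2 := by
    have e : x - 1 / w = ((v - w - 1 - ρ / w) + ρ / w) / w := by
      rw [hx]; field_simp; ring
    rw [e, norm_div]
    have h1 : ‖(v - w - 1 - ρ / w) + ρ / w‖ ≤ (‖ρ‖ + C) / ‖w‖ := by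
      refine (norm_add_le _ _).trans ?_
      rw [norm_div, add_div, add_comm]
      gcongr
      refine hb.trans ?_
      gcongr
      nlinarith
    calc _ ≤ (‖ρ‖ + C) / ‖w‖ / ‖w‖ := by gcongr
      _ = _ := by rw [div_div, sq]
  have e : v - ρ * Complex.log v - ((k + 1 : ℕ) : ℂ) - (w - ρ * Complex.log w - k)
      = (v - w - 1 - ρ / w) - ρ * ((Complex.log (1 + x) - x) + (x - 1 / w)) := by
    rw [← hl]; push_cast; field_simp; ring
  rw [e]
  calc _ ≤ ‖v - w - 1 - ρ / w‖ + ‖ρ‖ * (‖Complex.log (1 + x) - x‖ + ‖x - 1 / w‖) := by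
        refine (norm_sub_le _ _).trans ?_
        rw [norm_mul]
        gcongr
        exact norm_add_le _ _
    _ ≤ C / ‖w‖ ^ 2 + ‖ρ‖ * (2 / ‖w‖ ^ 2 + (‖ρ‖ + C) / ‖w‖ ^ 2) := by gcongr
    _ = _ := by ring

end

/-! ### The Abel function of a parabolic map -/

section

open Filter Topology Asymptotics

theorem isCompact_re_le_norm_le (c ε : ℝ) : IsCompact {z : ℂ | z.re ≤ -c ∧ ‖z‖ ≤ ε} := by
  have h : {z : ℂ | z.re ≤ -c ∧ ‖z‖ ≤ ε} = {z : ℂ | z.re ≤ -c} ∩ Metric.closedBall 0 ε := by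
    ext z; simp
  rw [h]
  exact (isCompact_closedBall 0 ε).inter_left
    (isClosed_le Complex.continuous_re continuous_const)

theorem summable_const_div_succ_sq (D : ℝ) : Summable fun k : ℕ => D / ((k : ℝ) + 1) ^ 2 := by
  have h := (Real.summable_one_div_nat_pow.2 (by norm_num : 1 < 2))
  have h2 := ((summable_nat_add_iff 1).2 h).mul_left D
  refine h2.congr fun k => ?_
  push_cast; ring

theorem fatouSeq_iterate (F : ℂ → ℂ) (ρ z : ℂ) (m n : ℕ) :
    fatouSeq F ρ (F^[m] z) n = fatouSeq F ρ z (n + m) + m := by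
  simp only [fatouSeq, ← Function.iterate_add_apply]
  push_cast; ring

theorem StepBound.norm_fatouSeq_succ_sub_le {F : ℂ → ℂ} {ρ : ℂ} {R C : ℝ}
    (hB : StepBound F ρ R C) (hF : ParabolicMap F ρ) {z : ℂ} (hz : z.re < 0)
    (hzR : 2 * R ≤ ‖wc z‖) (k : ℕ) :
    ‖fatouSeq F ρ z (k + 1) - fatouSeq F ρ z k‖ ≤
      (C + ‖ρ‖ * (2 + ‖ρ‖ + C)) * 16 / ((k : ℝ) + 1) ^ 2 := by
  have ho := (hB.orbit hF hz hzR k).2.2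
  have hk : (0 : ℝ) ≤ k := k.cast_nonneg
  have h4 := hB.four_le
  have hC := hB.nonneg
  refine (hB.norm_fatouSeq_succ_sub hF hz k (by linarith)).trans ?_
  rw [div_le_div_iff₀ (by have : 0 < ‖wc (F^[k] z)‖ := by linarith
                          positivity) (by positivity), mul_assoc]
  gcongr
  nlinarith

namespace ParabolicMap
variable {F : ℂ → ℂ} {ρ : ℂ}

theorem differentiableOn_fatouSeq (hF : ParabolicMap F ρ) (n : ℕ) :
    DifferentiableOn ℂ (fun z => fatouSeq F ρ z n) {z : ℂ | z.re < 0} := by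
  have h1 : DifferentiableOn ℂ (fun z => wc (F^[n] z)) {z : ℂ | z.re < 0} :=
    (differentiableOn_const _).div (hF.differentiableOn_iterate n) fun z hz =>
      ne_zero_of_re_neg (hF.iterate_re_neg hz n)
  exact ((h1.sub ((h1.clog fun z hz => Or.inl (wc_re_pos.2 (hF.iterate_re_neg hz n))).const_mul
    ρ)).sub_const _)

theorem eventually_norm_iterate_lt (hF : ParabolicMap F ρ) {z : ℂ} (hz : z.re < 0) {ε : ℝ}
    (hε : 0 < ε) : ∀ᶠ n in atTop, ‖F^[n] z‖ < ε := by
  have := (hF.tendsto_zero z hz).norm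
  rw [norm_zero] at this
  exact this.eventually_lt_const hε

theorem tendsto_fatouSeq_of_le (hF : ParabolicMap F ρ) {R C : ℝ} (hB : StepBound F ρ R C) {z : ℂ}
    (hz : z.re < 0) (hzR : 2 * R ≤ ‖wc z‖) :
    Tendsto (fatouSeq F ρ z) atTop (𝓝 (fatouSeq F ρ z 0 +
      ∑' k, (fatouSeq F ρ z (k + 1) - fatouSeq F ρ z k))) := by
  have hs : Summable fun k => fatouSeq F ρ z (k + 1) - fatouSeq F ρ z k :=
    Summable.of_norm_bounded (summable_const_div_succ_sq _)
      (hB.norm_fatouSeq_succ_sub_le hF hz hzR)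
  have := hs.hasSum.tendsto_sum_nat.const_add (fatouSeq F ρ z 0)
  refine this.congr fun n => ?_
  rw [Finset.sum_range_sub]; ring

theorem two_mul_le_norm_wc {R : ℝ} (hR : 4 ≤ R) {z : ℂ} (hz0 : z ≠ 0) (h : ‖z‖ < 1 / R) :
    2 * R ≤ ‖wc z‖ := by
  rw [norm_wc, le_div_iff₀ (norm_pos_iff.2 hz0)]
  rw [lt_div_iff₀ (by linarith)] at h
  linarith

theorem tendsto_fatou (hF : ParabolicMap F ρ) {z : ℂ} (hz : z.re < 0) :
    Tendsto (fatouSeq F ρ z) atTop (𝓝 (fatou F ρ z)) := by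
  obtain ⟨R, C, hB⟩ := hF.exists_stepBound
  have hR := hB.four_le
  obtain ⟨m, hm⟩ := (hF.eventually_norm_iterate_lt hz (by positivity : 0 < 1 / R)).exists
  have hzm := hF.iterate_re_neg hz m
  have h1 := hF.tendsto_fatouSeq_of_le hB hzm
    (two_mul_le_norm_wc hR (ne_zero_of_re_neg hzm) hm)
  have h2 : Tendsto (fun n => fatouSeq F ρ z (n + m)) atTop (𝓝 (_ - m)) :=
    (h1.sub_const (m : ℂ)).congr fun n => by rw [fatouSeq_iterate]; ring
  exact tendsto_nhds_limUnder ⟨_, (tendsto_add_atTop_iff_nat m).1 h2⟩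

theorem fatou_iterate (hF : ParabolicMap F ρ) {z : ℂ} (hz : z.re < 0) (m : ℕ) :
    fatou F ρ (F^[m] z) = fatou F ρ z + m := by
  have h1 := hF.tendsto_fatou (hF.iterate_re_neg hz m)
  have h2 := ((tendsto_add_atTop_iff_nat m).2 (hF.tendsto_fatou hz)).add_const (m : ℂ)
  refine tendsto_nhds_unique h1 (h2.congr fun n => ?_)
  rw [fatouSeq_iterate]

/-- The Abel equation. -/
theorem fatou_map (hF : ParabolicMap F ρ) {z : ℂ} (hz : z.re < 0) :
    fatou F ρ (F z) = fatou F ρ z + 1 := by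
  simpa using hF.fatou_iterate hz 1

theorem differentiableOn_fatou (hF : ParabolicMap F ρ) :
    DifferentiableOn ℂ (fatou F ρ) {z : ℂ | z.re < 0} := by
  obtain ⟨R, C, hB⟩ := hF.exists_stepBound
  have hR := hB.four_le
  set U : Set ℂ := {z : ℂ | z.re < 0} ∩ Metric.ball 0 (1 / R) with hU
  have hUo : IsOpen U := isOpen_re_neg.inter Metric.isOpen_ball
  have hUR : ∀ z ∈ U, 2 * R ≤ ‖wc z‖ := fun z hz =>
    two_mul_le_norm_wc hR (ne_zero_of_re_neg hz.1) (by simpa using hz.2)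
  have hdU : DifferentiableOn ℂ (fatou F ρ) U := by
    have h1 : DifferentiableOn ℂ
        (fun z => ∑' k, (fatouSeq F ρ z (k + 1) - fatouSeq F ρ z k)) U :=
      Complex.differentiableOn_tsum_of_summable_norm (summable_const_div_succ_sq _)
        (fun k => ((hF.differentiableOn_fatouSeq (k + 1)).sub
          (hF.differentiableOn_fatouSeq k)).mono Set.inter_subset_left) hUo
        (fun k z hz => hB.norm_fatouSeq_succ_sub_le hF hz.1 (hUR z hz) k)
    refine (((hF.differentiableOn_fatouSeq 0).mono Set.inter_subset_left).add h1).congr ?_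
    intro z hz
    exact tendsto_nhds_unique (hF.tendsto_fatou hz.1)
      (hF.tendsto_fatouSeq_of_le hB hz.1 (hUR z hz))
  intro z hz
  obtain ⟨m, hm⟩ := (hF.eventually_norm_iterate_lt hz (by positivity : 0 < 1 / R)).exists
  have hzm : F^[m] z ∈ U := ⟨hF.iterate_re_neg hz m, by simpa using hm⟩
  have hd : DifferentiableAt ℂ F^[m] z :=
    (hF.differentiableOn_iterate m).differentiableAt (isOpen_re_neg.mem_nhds hz)
  have h2 : DifferentiableAt ℂ (fun y => fatou F ρ (F^[m] y) - m) z :=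
    ((hdU.differentiableAt (hUo.mem_nhds hzm)).comp z hd).sub_const _
  refine (h2.congr_of_eventuallyEq ?_).differentiableWithinAt
  filter_upwards [isOpen_re_neg.mem_nhds hz] with y hy
  rw [hF.fatou_iterate hy]; ring

/-- Near `0`, the Abel function is `w - ρ log w` up to a bounded error. -/
theorem exists_norm_fatou_sub_le (hF : ParabolicMap F ρ) : ∃ R M : ℝ, 0 < R ∧ 0 ≤ M ∧
    ∀ z : ℂ, z.re < 0 → R ≤ ‖wc z‖ →
      ‖fatou F ρ z - (wc z - ρ * Complex.log (wc z))‖ ≤ M := by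
  obtain ⟨R, C, hB⟩ := hF.exists_stepBound
  have hR := hB.four_le
  have hC := hB.nonneg
  refine ⟨2 * R, ∑' k : ℕ, (C + ‖ρ‖ * (2 + ‖ρ‖ + C)) * 16 / ((k : ℝ) + 1) ^ 2, by linarith,
    tsum_nonneg fun k => by positivity, fun z hz hzR => ?_⟩
  have h1 := tendsto_nhds_unique (hF.tendsto_fatou hz) (hF.tendsto_fatouSeq_of_le hB hz hzR)
  have h2 : fatouSeq F ρ z 0 = wc z - ρ * Complex.log (wc z) := by simp [fatouSeq]
  rw [h1, ← h2, add_sub_cancel_left]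
  exact tsum_of_norm_bounded (summable_const_div_succ_sq _).hasSum
    (hB.norm_fatouSeq_succ_sub_le hF hz hzR)

theorem tendsto_re_wc_iterate (hF : ParabolicMap F ρ) {z : ℂ} (hz : z.re < 0) :
    Tendsto (fun n => (wc (F^[n] z)).re) atTop atTop := by
  obtain ⟨R, C, hB⟩ := hF.exists_stepBound
  have hR := hB.four_le
  obtain ⟨m, hm⟩ := (hF.eventually_norm_iterate_lt hz (by positivity : 0 < 1 / R)).exists
  have hzm := hF.iterate_re_neg hz m
  rw [← tendsto_add_atTop_iff_nat m]
  have h : Tendsto (fun n : ℕ => (wc (F^[m] z)).re + 3 / 4 * (n : ℝ)) atTop atTop :=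
    tendsto_atTop_add_const_left _ _
      (tendsto_natCast_atTop_atTop.const_mul_atTop (by norm_num))
  refine tendsto_atTop_mono (fun n => ?_) h
  rw [Function.iterate_add_apply]
  exact (hB.orbit hF hzm (two_mul_le_norm_wc hR (ne_zero_of_re_neg hzm) hm) n).1

/-- `w_n / n → 1`, as the Cesàro limit of the increments `w_{n+1} - w_n → 1`. -/
theorem tendsto_wc_iterate_div (hF : ParabolicMap F ρ) {z : ℂ} (hz : z.re < 0) :
    Tendsto (fun n : ℕ => wc (F^[n] z) / n) atTop (𝓝 1) := by
  have h0 := hF.tendsto_zero z hz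
  have hexp : (fun x => F x - x - 1 / 2 * x ^ 2) =O[𝓝 0] (fun x : ℂ => x ^ 3) := by
    have h1 : (fun x : ℂ => x ^ 4) =O[𝓝 0] (fun x : ℂ => x ^ 3) :=
      isBigO_pow_of_le tendsto_id (by norm_num)
    have h2 := (hF.expansion.trans h1).add
      ((isBigO_refl (fun x : ℂ => x ^ 3) (𝓝 0)).const_mul_left ((1 - ρ) / 4))
    refine h2.congr_left fun x => by ring
  have h1 : Tendsto (fun n => wc (F^[n + 1] z) - wc (F^[n] z)) atTop (𝓝 1) := by
    refine tendsto_wc_sub_wc h0 (Eventually.of_forall fun n =>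
      ne_zero_of_re_neg (hF.iterate_re_neg hz n)) ?_
    refine (hexp.comp_tendsto h0).congr_left fun n => ?_
    simp only [Function.comp_apply, Function.iterate_succ_apply']
  have h2 := h1.cesaro_smul
  have h3 : Tendsto (fun n : ℕ => wc z / n) atTop (𝓝 0) :=
    tendsto_const_div_atTop_nhds_zero_nat _
  have h4 := h2.add h3
  rw [add_zero] at h4
  refine h4.congr fun n => ?_
  rw [Finset.sum_range_sub (fun i => wc (F^[i] z))]
  simp only [Function.iterate_zero, id, Complex.real_smul]
  push_cast
  ring

theorem tendsto_log_wc_sub_log (hF : ParabolicMap F ρ) {z : ℂ} (hz : z.re < 0) :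
    Tendsto (fun n : ℕ => Complex.log (wc (F^[n] z)) - (Real.log n : ℂ)) atTop (𝓝 0) := by
  have h1 := (hF.tendsto_wc_iterate_div hz).clog (by simp)
  rw [Complex.log_one] at h1
  refine h1.congr' ?_
  filter_upwards [eventually_gt_atTop 0] with n hn
  have hn' : (0 : ℝ) < n := by exact_mod_cast hn
  have hw := wc_ne_zero (hF.iterate_re_neg hz n)
  have e : wc (F^[n] z) / n = ((n : ℝ)⁻¹ : ℝ) * wc (F^[n] z) := by push_cast; ring
  rw [e, Complex.log_ofReal_mul (inv_pos.2 hn') hw, Real.log_inv]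
  push_cast; ring

/-- The Abel function as a limit in which the iterates enter only through `-2 / F^n(z)`. -/
theorem tendsto_wc_sub_log_sub (hF : ParabolicMap F ρ) {z : ℂ} (hz : z.re < 0) :
    Tendsto (fun n : ℕ => wc (F^[n] z) - ρ * (Real.log n : ℂ) - n) atTop
      (𝓝 (fatou F ρ z)) := by
  have h := (hF.tendsto_fatou hz).add ((hF.tendsto_log_wc_sub_log hz).const_mul ρ)
  rw [mul_zero, add_zero] at h
  refine h.congr fun n => ?_
  simp only [fatouSeq]; ring

/-- With `ρ log (-z_n)` in place of `-ρ log n`, the limit changes by `ρ log 2`, as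
`-z_n = 2 / w_n`. -/
theorem tendsto_log_neg_add_wc_sub (hF : ParabolicMap F ρ) {z : ℂ} (hz : z.re < 0) :
    Tendsto (fun n : ℕ => ρ * Complex.log (-(F^[n] z)) + wc (F^[n] z) - n) atTop
      (𝓝 (fatou F ρ z + ρ * (Real.log 2 : ℂ))) := by
  have h := (hF.tendsto_fatou hz).add_const (ρ * (Real.log 2 : ℂ))
  refine h.congr fun n => ?_
  have hw := wc_re_pos.2 (hF.iterate_re_neg hz n)
  have e : -(F^[n] z) = ((2 : ℝ) : ℂ) * (wc (F^[n] z))⁻¹ := by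
    simp only [wc, inv_div]; push_cast; ring
  have a1 := abs_lt.1 (Complex.abs_arg_lt_pi_div_two_iff.2 (Or.inl hw))
  rw [e, Complex.log_ofReal_mul two_pos (inv_ne_zero (ne_zero_of_re_pos hw)), Complex.log_inv]
  · simp only [fatouSeq]; ring
  · intro h; rw [h] at a1; linarith [Real.pi_pos]

/-- In the coordinate `w`, the Abel function is a translation up to a Lipschitz error that is
arbitrarily small far to the right: it differs from the identity by the slowly varying
`ρ log w` and a bounded holomorphic function, whose derivative is small by Cauchy's estimate. -/
theorem exists_fatou_sub_approx (hF : ParabolicMap F ρ) {ε : ℝ} (hε : 0 < ε) :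
    ∃ T : ℝ, 0 < T ∧ ∀ x y : ℂ, T < (wc x).re → T < (wc y).re →
      ‖fatou F ρ x - fatou F ρ y - (wc x - wc y)‖ ≤ ε * ‖wc x - wc y‖ := by
  obtain ⟨R, M, hR, hM, hb⟩ := hF.exists_norm_fatou_sub_le
  -- the radius of the discs in Cauchy's estimate
  set T₁ : ℝ := (M + ‖ρ‖ + 1) / ε with hT₁
  have hT₁p : 0 < T₁ := by positivity
  have hneg : ∀ W : ℂ, 0 < W.re → (wc W).re < 0 := fun W hW => by
    rw [← wc_re_pos, wc_wc]; exact hW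
  have hopen : IsOpen {W : ℂ | 0 < W.re} := isOpen_lt continuous_const Complex.continuous_re
  have hda : DifferentiableOn ℂ (fun W => fatou F ρ (wc W)) {W : ℂ | 0 < W.re} :=
    hF.differentiableOn_fatou.comp
      ((differentiableOn_const _).div differentiableOn_id fun W hW => ne_zero_of_re_pos hW)
      fun W hW => hneg W hW
  have hdl : DifferentiableOn ℂ (fun W => ρ * Complex.log W) {W : ℂ | 0 < W.re} :=
    (differentiableOn_id.clog fun W hW => Or.inl hW).const_mul ρ
  set b : ℂ → ℂ := fun W => fatou F ρ (wc W) - (W - ρ * Complex.log W) with hbdef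
  have hdb : DifferentiableOn ℂ b {W : ℂ | 0 < W.re} := hda.sub (differentiableOn_id.sub hdl)
  have hbM : ∀ W : ℂ, 0 < W.re → R ≤ ‖W‖ → ‖b W‖ ≤ M := fun W hW hWR => by
    have := hb (wc W) (hneg W hW) (by rwa [wc_wc])
    rwa [wc_wc] at this
  set e : ℂ → ℂ := fun W => fatou F ρ (wc W) - W with hedef
  have hde : DifferentiableOn ℂ e {W : ℂ | 0 < W.re} := hda.sub differentiableOn_id
  have hderiv : ∀ W ∈ {W : ℂ | R + T₁ < W.re}, ‖deriv e W‖ ≤ ε := by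
    intro W hW
    have hW : R + T₁ < W.re := hW
    have hW0 : 0 < W.re := by linarith
    have hsub : ∀ V ∈ Metric.closedBall W T₁, R < V.re := by
      intro V hV
      have h1 : |(V - W).re| ≤ T₁ :=
        (Complex.abs_re_le_norm _).trans (by simpa [dist_eq_norm] using hV)
      rw [Complex.sub_re, abs_le] at h1
      linarith [h1.1]
    have h1 : ‖deriv b W‖ ≤ M / T₁ := by
      refine Complex.norm_deriv_le_of_forall_mem_sphere_norm_le hT₁p ?_ ?_
      · refine DifferentiableOn.diffContOnCl_ball (U := {W : ℂ | 0 < W.re}) hdb ?_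
        intro V hV
        exact hR.trans (hsub V hV)
      · intro V hV
        have := hsub V (Metric.sphere_subset_closedBall hV)
        exact hbM V (hR.trans this) (this.le.trans (Complex.re_le_norm V))
    have hWs : W ∈ Complex.slitPlane := Or.inl hW0
    have h2 : HasDerivAt (fun W => ρ * Complex.log W) (ρ * W⁻¹) W :=
      (Complex.hasDerivAt_log hWs).const_mul ρ
    have h3 : HasDerivAt b (deriv b W) W :=
      (hdb.differentiableAt (hopen.mem_nhds hW0)).hasDerivAt
    have h4 : HasDerivAt e (deriv b W - ρ * W⁻¹) W := by
      refine (h3.sub h2).congr_of_eventuallyEq (Eventually.of_forall fun V => ?_)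
      simp only [hedef, hbdef, Pi.sub_apply]; ring
    rw [h4.deriv]
    have h5 : T₁ ≤ ‖W‖ := by linarith [Complex.re_le_norm W]
    calc ‖deriv b W - ρ * W⁻¹‖ ≤ M / T₁ + ‖ρ‖ / T₁ := by
          refine (norm_sub_le _ _).trans (add_le_add h1 ?_)
          rw [norm_mul, norm_inv, ← div_eq_mul_inv]
          gcongr
      _ ≤ ε := by
          rw [← add_div, div_le_iff₀ hT₁p, hT₁, mul_div_cancel₀ _ hε.ne']
          linarith
  refine ⟨R + T₁, by positivity, fun x y hx hy => ?_⟩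
  have hconv : Convex ℝ {W : ℂ | R + T₁ < W.re} := convex_halfSpace_re_gt _
  have h := hconv.norm_image_sub_le_of_norm_deriv_le (f := e) (C := ε) (x := wc y) (y := wc x)
    (fun W (hW : R + T₁ < W.re) => hde.differentiableAt (hopen.mem_nhds (by
      show 0 < W.re
      linarith))) hderiv hy hx
  have e1 : fatou F ρ x - fatou F ρ y - (wc x - wc y) = e (wc x) - e (wc y) := by
    simp only [hedef, wc_wc]; ring
  rw [e1]
  exact h

theorem tendsto_fatou_sub_fatou (hF : ParabolicMap F ρ) {ι : Type*} {l : Filter ι} {x y : ι → ℂ}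
    {s : ℂ} (hx : Tendsto (fun i => (wc (x i)).re) l atTop)
    (hxy : Tendsto (fun i => wc (y i) - wc (x i)) l (𝓝 s)) :
    Tendsto (fun i => fatou F ρ (y i) - fatou F ρ (x i)) l (𝓝 s) := by
  have hy : Tendsto (fun i => (wc (y i)).re) l atTop := by
    have h1 : Tendsto (fun i => (wc (y i) - wc (x i)).re) l (𝓝 s.re) :=
      (Complex.continuous_re.tendsto s).comp hxy
    refine (hx.atTop_add h1).congr fun i => ?_
    simp
  have hlo : (fun i => fatou F ρ (y i) - fatou F ρ (x i) - (wc (y i) - wc (x i))) =o[l]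
      fun i => wc (y i) - wc (x i) := by
    rw [isLittleO_iff]
    intro ε hε
    obtain ⟨T, -, hT⟩ := hF.exists_fatou_sub_approx hε
    filter_upwards [hx.eventually_gt_atTop T, hy.eventually_gt_atTop T] with i h1 h2
    exact hT _ _ h2 h1
  have h0 := (isLittleO_one_iff ℂ).1 (hlo.trans_isBigO (hxy.isBigO_one ℂ))
  simpa using h0.add hxy

theorem injOn_fatou (hF : ParabolicMap F ρ) : Set.InjOn (fatou F ρ) leftPetal := by
  obtain ⟨T, -, hT⟩ := hF.exists_fatou_sub_approx (by norm_num : (0 : ℝ) < 1 / 2)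
  intro x hx y hy hxy
  obtain ⟨n, h1, h2⟩ := (((hF.tendsto_re_wc_iterate hx.1).eventually_gt_atTop T).and
    ((hF.tendsto_re_wc_iterate hy.1).eventually_gt_atTop T)).exists
  have h3 := hT _ _ h1 h2
  rw [hF.fatou_iterate hx.1, hF.fatou_iterate hy.1, hxy, sub_self, zero_sub, norm_neg] at h3
  have h4 : ‖wc (F^[n] x) - wc (F^[n] y)‖ = 0 := by
    have := norm_nonneg (wc (F^[n] x) - wc (F^[n] y))
    linarith
  have h5 : F^[n] x = F^[n] y := by
    rw [← wc_wc (F^[n] x), sub_eq_zero.1 (norm_eq_zero.1 h4), wc_wc]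
  exact hF.injOn.iterate (fun z hz => hF.mapsTo_petal z hz) n hx hy h5

/-- Arbitrarily close to `0` there are points of the petal whose Abel coordinate, translated by
`s`, is again the Abel coordinate of a point of the petal. -/
theorem exists_fatou_eq_add (hF : ParabolicMap F ρ) (s : ℂ) {δ : ℝ} (hδ : 0 < δ) :
    ∃ z ∈ leftPetal, ‖z‖ < δ ∧ ∃ z' ∈ leftPetal, fatou F ρ z' = fatou F ρ z + s := by
  obtain ⟨T, hT0, hT⟩ := hF.exists_fatou_sub_approx (by norm_num : (0 : ℝ) < 1 / 2)
  -- the image of the disc of radius `r` contains a disc of radius `r / 4 > ‖s‖`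
  set r : ℝ := 4 * ‖s‖ + 1 with hr
  have hr0 : 0 < r := by positivity
  set x : ℝ := T + r + 1 + 2 / δ with hx
  have hxpos : 0 < x := by positivity
  have hball : ∀ V ∈ Metric.closedBall (x : ℂ) r, T < V.re ∧ 1 < V.re := by
    intro V hV
    have h1 : |(V - x).re| ≤ r :=
      (Complex.abs_re_le_norm _).trans (by simpa [dist_eq_norm] using hV)
    rw [Complex.sub_re, Complex.ofReal_re, abs_le] at h1
    have : 0 < 2 / δ := by positivity
    constructor <;> linarith [h1.1]
  have hpetal : ∀ V : ℂ, 1 < V.re → wc V ∈ leftPetal := by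
    intro V hV
    refine ⟨by rw [← wc_re_pos, wc_wc]; linarith, ?_⟩
    refine (Complex.abs_im_le_norm _).trans_lt ?_
    rw [norm_wc, div_lt_iff₀ (by linarith [Complex.re_le_norm V])]
    nlinarith [Complex.re_le_norm V, Real.pi_gt_three]
  have hd : DifferentiableOn ℂ (fun W => fatou F ρ (wc W)) {W : ℂ | 0 < W.re} :=
    hF.differentiableOn_fatou.comp
      ((differentiableOn_const _).div differentiableOn_id fun W hW => ne_zero_of_re_pos hW)
      fun W (hW : 0 < W.re) => by
        show (wc W).re < 0
        rwa [← wc_re_pos, wc_wc]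
  have hcl : DiffContOnCl ℂ (fun W => fatou F ρ (wc W)) (Metric.ball (x : ℂ) r) :=
    DifferentiableOn.diffContOnCl_ball hd fun V hV => hT0.trans (hball V hV).1
  have hxb := hball x (Metric.mem_closedBall_self hr0.le)
  have hexp : ∀ V ∈ Metric.closedBall (x : ℂ) r,
      ‖V - x‖ / 2 ≤ ‖fatou F ρ (wc V) - fatou F ρ (wc x)‖ := by
    intro V hV
    have h1 := hT (wc V) (wc x) (by rw [wc_wc]; exact (hball V hV).1)
      (by rw [wc_wc]; exact hxb.1)
    rw [wc_wc, wc_wc] at h1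
    have h3 := norm_sub_norm_le (V - (x : ℂ)) (fatou F ρ (wc V) - fatou F ρ (wc x))
    rw [norm_sub_rev] at h1
    linarith
  have himg := hcl.ball_subset_image_closedBall hr0 (ε := r / 2) (fun V hV => by
    have h1 := hexp V (Metric.sphere_subset_closedBall hV)
    have h2 : ‖V - x‖ = r := by simpa [dist_eq_norm] using hV
    rwa [h2] at h1) (by
    have h1 : ∀ᶠ V in 𝓝[≠] (x : ℂ), fatou F ρ (wc V) ≠ fatou F ρ (wc x) := by
      filter_upwards [self_mem_nhdsWithin,
        nhdsWithin_le_nhds (Metric.closedBall_mem_nhds (x : ℂ) hr0)] with V hne hV he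
      have h2 := hexp V hV
      rw [he, sub_self, norm_zero] at h2
      have h3 : 0 < ‖V - x‖ := norm_pos_iff.2 (sub_ne_zero.2 hne)
      linarith
    exact h1.frequently.filter_mono nhdsWithin_le_nhds)
  have hmem : fatou F ρ (wc x) + s ∈ Metric.ball (fatou F ρ (wc x)) (r / 2 / 2) := by
    simp [hr]; linarith
  obtain ⟨V, hV, hVs⟩ := himg hmem
  refine ⟨wc x, hpetal _ hxb.2, ?_, wc V, hpetal _ (hball V hV).2, hVs⟩
  rw [norm_wc, Complex.norm_real, Real.norm_of_nonneg hxpos.le, div_lt_iff₀ hxpos, hx]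
  have : δ * (2 / δ) = 2 := by field_simp
  nlinarith [mul_pos hδ hT0, mul_pos hδ hr0]

/-- The Abel function `α` satisfies `Re α + |Im α| → +∞` at `0` in the left half-plane. The
real part alone does not suffice, because `0` may be approached tangentially to the imaginary
axis. -/
theorem exists_lt_fatou (hF : ParabolicMap F ρ) (B : ℝ) : ∃ δ > 0, ∀ z : ℂ, z.re < 0 →
    ‖z‖ < δ → B < (fatou F ρ z).re + |(fatou F ρ z).im| := by
  obtain ⟨R, M, hR, hM, hb⟩ := hF.exists_norm_fatou_sub_le
  have hlog : ∀ᶠ x : ℝ in atTop, 2 * ‖ρ‖ * Real.log x ≤ x / 2 := by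
    have h1 := Real.isLittleO_log_id_atTop.const_mul_left (2 * ‖ρ‖)
    filter_upwards [h1.def (by norm_num : (0 : ℝ) < 1 / 2), eventually_ge_atTop 0] with x hx h0
    simp only [id, Real.norm_eq_abs, abs_of_nonneg h0] at hx
    linarith [le_abs_self (2 * ‖ρ‖ * Real.log x)]
  obtain ⟨X, hX⟩ := eventually_atTop.1 (hlog.and (eventually_ge_atTop (1 : ℝ)))
  set Y : ℝ := max (max X R) (2 * (|B| + 2 * M + 2 * ‖ρ‖ * Real.pi) + 1) with hY
  have hY0 : 0 < Y := lt_of_lt_of_le hR ((le_max_right _ _).trans (le_max_left _ _))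
  refine ⟨2 / Y, by positivity, fun z hz hzY => ?_⟩
  have hwY : Y < ‖wc z‖ := by
    rw [norm_wc, lt_div_iff₀ (norm_pos_iff.2 (ne_zero_of_re_neg hz))]
    rw [lt_div_iff₀ hY0] at hzY
    linarith
  have h1 := hb z hz (((le_max_right _ _).trans (le_max_left _ _)).trans hwY.le)
  obtain ⟨h2, h2'⟩ := hX _ (((le_max_left _ _).trans (le_max_left _ _)).trans hwY.le)
  have h3 : 2 * (|B| + 2 * M + 2 * ‖ρ‖ * Real.pi) + 1 < ‖wc z‖ :=
    (le_max_right _ _).trans_lt hwY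
  have hwre := wc_re_pos.2 hz
  set w := wc z
  have h4 : ‖ρ * Complex.log w‖ ≤ ‖ρ‖ * (Real.log ‖w‖ + Real.pi) := by
    rw [norm_mul]
    gcongr
    refine (Complex.norm_le_abs_re_add_abs_im _).trans ?_
    rw [Complex.log_re, Complex.log_im, abs_of_nonneg (Real.log_nonneg h2')]
    gcongr
    exact Complex.abs_arg_le_pi w
  have h5 : ‖fatou F ρ z - w‖ ≤ M + ‖ρ‖ * (Real.log ‖w‖ + Real.pi) := by
    have e : fatou F ρ z - w = (fatou F ρ z - (w - ρ * Complex.log w)) - ρ * Complex.log w := by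
      ring
    rw [e]
    exact (norm_sub_le _ _).trans (add_le_add h1 h4)
  have hre := (Complex.abs_re_le_norm _).trans h5
  have him := (Complex.abs_im_le_norm _).trans h5
  rw [Complex.sub_re, abs_le] at hre
  rw [Complex.sub_im] at him
  have h6 := abs_sub_abs_le_abs_sub w.im (fatou F ρ z).im
  rw [abs_sub_comm] at h6
  have h7 : ‖w‖ ≤ |w.re| + |w.im| := Complex.norm_le_abs_re_add_abs_im w
  rw [abs_of_pos hwre] at h7
  have h8 := le_abs_self B
  nlinarith [hre.1]

/-- Away from `0`, `Re α + |Im α|` is bounded above on the petal: every orbit enters the disc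
`‖z‖ < ε` through a fixed compact subset of the half-plane, and along the orbit `α` only moves
to the right. For the inverse branch, `|α|` itself is unbounded there. -/
theorem exists_fatou_le (hF : ParabolicMap F ρ) {ε : ℝ} (hε : 0 < ε) : ∃ B : ℝ,
    ∀ z ∈ leftPetal, ε ≤ ‖z‖ → (fatou F ρ z).re + |(fatou F ρ z).im| ≤ B := by
  obtain ⟨c, hc, hpush⟩ := hF.push ε hε
  have hK := isCompact_re_le_norm_le c ε
  have hcont : ContinuousOn (fatou F ρ) {z : ℂ | z.re ≤ -c ∧ ‖z‖ ≤ ε} :=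
    hF.differentiableOn_fatou.continuousOn.mono fun z hz => by
      have : z.re ≤ -c := hz.1
      show z.re < 0
      linarith
  obtain ⟨B, hB⟩ := hK.exists_bound_of_continuousOn hcont
  refine ⟨2 * B, fun z hz hzε => ?_⟩
  have hex : ∃ n, ‖F^[n] z‖ < ε := (hF.eventually_norm_iterate_lt hz.1 hε).exists
  classical
  -- the first entry into the disc `‖z‖ < ε`
  obtain ⟨k, hk⟩ : ∃ k, Nat.find hex = k + 1 := by
    refine Nat.exists_eq_succ_of_ne_zero fun h => ?_
    have := Nat.find_spec hex
    rw [h] at this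
    exact absurd this (not_lt.2 hzε)
  have h1 : ‖F^[k + 1] z‖ < ε := hk ▸ Nat.find_spec hex
  have h2 : ε ≤ ‖F^[k] z‖ := not_lt.1 (Nat.find_min hex (by omega))
  have h3 := hpush _ (hF.iterate_mem_petal hz k) h2
  rw [← Function.iterate_succ_apply' F k z] at h3
  have h4 := hB _ ⟨h3, h1.le⟩
  rw [hF.fatou_iterate hz.1] at h4
  have h5 := (le_abs_self _).trans ((Complex.abs_re_le_norm _).trans h4)
  have h6 := (Complex.abs_im_le_norm _).trans h4
  simp only [Complex.add_re, Complex.add_im, Complex.natCast_re, Complex.natCast_im,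
    add_zero] at h5 h6
  have : (0 : ℝ) ≤ ((k + 1 : ℕ) : ℝ) := Nat.cast_nonneg _
  linarith

/-- If `α(z') = α(z) + s` with `z` close to `0`, then `z'` is close to `0`. -/
theorem norm_lt_of_fatou_eq_add (hF : ParabolicMap F ρ) (s : ℂ) {ε : ℝ} (hε : 0 < ε) :
    ∃ δ > 0, ∀ z z' : ℂ, z.re < 0 → z' ∈ leftPetal → ‖z‖ < δ →
      fatou F ρ z' = fatou F ρ z + s → ‖z'‖ < ε := by
  obtain ⟨B, hB⟩ := hF.exists_fatou_le hε
  obtain ⟨δ, hδ, h⟩ := hF.exists_lt_fatou (B + 2 * ‖s‖)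
  refine ⟨δ, hδ, fun z z' hz hz' hzδ he => ?_⟩
  by_contra hcon
  have h1 := hB z' hz' (not_lt.1 hcon)
  have h2 := h z hz hzδ
  rw [he] at h1
  simp only [Complex.add_re, Complex.add_im] at h1
  have h3 := (abs_le.1 (Complex.abs_re_le_norm s)).1
  have h4 := Complex.abs_im_le_norm s
  have h5 := abs_sub_abs_le_abs_sub (fatou F ρ z).im (-s.im)
  rw [abs_neg, sub_neg_eq_add] at h5
  linarith

/-- A first-order expansion along orbits determines the shift of the Abel coordinate. -/
theorem fatou_eq_add_of_isBigO (hF : ParabolicMap F ρ) {z z' s : ℂ} (hz : z.re < 0)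
    (hz' : z'.re < 0)
    (h : (fun n => F^[n] z' - F^[n] z - s / 2 * (F^[n] z) ^ 2) =O[atTop]
      fun n => (F^[n] z) ^ 3) :
    fatou F ρ z' = fatou F ρ z + s := by
  have h1 := tendsto_wc_sub_wc (hF.tendsto_zero z hz) (Eventually.of_forall fun n =>
      ne_zero_of_re_neg (hF.iterate_re_neg hz n)) h
  have h2 := hF.tendsto_fatou_sub_fatou (hF.tendsto_re_wc_iterate hz) h1
  have h3 : ∀ n, fatou F ρ (F^[n] z') - fatou F ρ (F^[n] z) = fatou F ρ z' - fatou F ρ z := by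
    intro n
    rw [hF.fatou_iterate hz, hF.fatou_iterate hz']; ring
  simp only [h3] at h2
  have := tendsto_nhds_unique h2 tendsto_const_nhds
  rw [this]; ring

end ParabolicMap

end

/-! ### Asymptotic expansion of the translations of the Abel coordinate -/

section

open Filter Topology Asymptotics

namespace ParabolicMap
variable {F : ℂ → ℂ} {ρ : ℂ}

/-- If `p z = z + (s / 2) z² + O(z³)` commutes with `F` up to a high order, then `p` is, up to a
high order, the translation by `s` in the Abel coordinate. The defect `α(p z) - α(z) - s` tends
to `0` along orbits, and its increments along orbits are controlled by `p(F z) - F(p z)`. -/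
theorem exists_norm_fatou_comp_sub_le (hF : ParabolicMap F ρ) {p : ℂ → ℂ} {s : ℂ} (K : ℕ)
    (hp : (fun z => p z - z - s / 2 * z ^ 2) =O[𝓝 0] (fun z : ℂ => z ^ 3))
    (hc : (fun z => p (F z) - F (p z)) =O[𝓝 0] (fun z : ℂ => z ^ (K + 4))) (T₀ : ℝ) :
    ∃ T C : ℝ, 0 ≤ C ∧ ∀ z : ℂ, T < (wc z).re →
      T₀ < (wc (p z)).re ∧ ‖fatou F ρ (p z) - fatou F ρ z - s‖ ≤ C * ‖z‖ ^ K := by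
  obtain ⟨R, CB, hB⟩ := hF.exists_stepBound
  have hR := hB.four_le
  obtain ⟨T₁, hT₁0, hT₁⟩ := hF.exists_fatou_sub_approx (by norm_num : (0 : ℝ) < 1 / 2)
  have hw : Tendsto (fun z => wc (p z) - wc z) (𝓝[≠] 0) (𝓝 s) :=
    tendsto_wc_sub_wc (x := fun z => z) (tendsto_id.mono_left nhdsWithin_le_nhds)
      self_mem_nhdsWithin (hp.mono nhdsWithin_le_nhds)
  obtain ⟨C₁, hC₁, hcC⟩ := hc.exists_pos
  have hev : ∀ᶠ z in 𝓝[≠] (0 : ℂ), ‖wc (p z) - wc z - s‖ ≤ 1 ∧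
      ‖p (F z) - F (p z)‖ ≤ C₁ * ‖z ^ (K + 4)‖ := by
    refine Eventually.and ?_ (nhdsWithin_le_nhds hcC.bound)
    filter_upwards [Metric.tendsto_nhds.1 hw 1 one_pos] with z hz
    exact (dist_eq_norm (wc (p z) - wc z) s ▸ hz).le
  obtain ⟨r, hr, hrev⟩ := Metric.mem_nhdsWithin_iff.1 hev
  set T₂ : ℝ := max T₀ T₁
  have hT₂ : 0 < T₂ := hT₁0.trans_le (le_max_right _ _)
  -- to the right of `T`, all the estimates hold for `z` and for `p z`
  set T : ℝ := T₂ + ‖s‖ + 2 + 2 * R + 2 / r with hT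
  have hr' : 0 < 2 / r := by positivity
  have hs0 := norm_nonneg s
  have hreg : ∀ z : ℂ, T < (wc z).re → z.re < 0 ∧ 2 * R ≤ ‖wc z‖ ∧ T < ‖wc z‖ ∧
      ‖wc (p z) - wc z - s‖ ≤ 1 ∧ ‖p (F z) - F (p z)‖ ≤ C₁ * ‖z ^ (K + 4)‖ ∧
      T₂ + 2 * R < (wc (p z)).re := by
    intro z hz
    have hz0 : z.re < 0 := wc_re_pos.1 (by linarith)
    have h1 : T < ‖wc z‖ := hz.trans_le (Complex.re_le_norm _)
    have h2 : ‖z‖ < r := by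
      rw [norm_eq_div_norm_wc, div_lt_iff₀ (by linarith)]
      have : 2 / r < ‖wc z‖ := by linarith
      rw [div_lt_iff₀ hr] at this
      linarith
    obtain ⟨h3, h4⟩ := hrev ⟨by simpa using h2, ne_zero_of_re_neg hz0⟩
    refine ⟨hz0, by linarith, h1, h3, h4, ?_⟩
    have h5 := (abs_le.1 ((Complex.abs_re_le_norm _).trans h3)).1
    have h6 := (abs_le.1 (Complex.abs_re_le_norm s)).1
    simp only [Complex.sub_re] at h5
    linarith
  have hstep1 : ∀ z : ℂ, z.re < 0 → R ≤ ‖wc z‖ →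
      (wc z).re ≤ (wc (F z)).re ∧ ‖wc (F z)‖ ≤ ‖wc z‖ + 5 / 4 := by
    intro z hz hzR
    have h1 := hB.step z hz hzR
    have h2 := (abs_le.1 ((Complex.abs_re_le_norm _).trans h1)).1
    simp only [Complex.sub_re, Complex.one_re] at h2
    refine ⟨by linarith, ?_⟩
    calc ‖wc (F z)‖ = ‖(wc (F z) - wc z - 1) + wc z + 1‖ := by congr 1; ring
      _ ≤ ‖wc (F z) - wc z - 1‖ + ‖wc z‖ + ‖(1 : ℂ)‖ := norm_add₃_le
      _ ≤ _ := by rw [norm_one]; linarith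
  have hnp : ∀ z : ℂ, ‖wc (p z) - wc z - s‖ ≤ 1 → ‖wc (p z)‖ ≤ ‖wc z‖ + ‖s‖ + 1 := by
    intro z hz
    calc ‖wc (p z)‖ = ‖(wc (p z) - wc z - s) + wc z + s‖ := by congr 1; ring
      _ ≤ ‖wc (p z) - wc z - s‖ + ‖wc z‖ + ‖s‖ := norm_add₃_le
      _ ≤ _ := by linarith
  -- the defect; by the Abel equation, `d (F z) - d z = α(p (F z)) - α(F (p z))`
  set d : ℂ → ℂ := fun z => fatou F ρ (p z) - fatou F ρ z - s with hd
  have hinc : ∀ z : ℂ, T < (wc z).re → ‖d (F z) - d z‖ ≤ 12 * C₁ * ‖z‖ ^ (K + 2) := by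
    intro z hz
    obtain ⟨hz0, hz2R, hzT, hzp, hzc, hzpre⟩ := hreg z hz
    obtain ⟨hFre, hFn⟩ := hstep1 z hz0 (by linarith)
    obtain ⟨-, -, -, hFp, -, hFpre⟩ := hreg (F z) (hz.trans_le hFre)
    have hpz0 : (p z).re < 0 := wc_re_pos.1 (by linarith)
    obtain ⟨hpre, hpn⟩ := hstep1 (p z) hpz0
      (by linarith [Complex.re_le_norm (wc (p z))])
    have hT₁T₂ : T₁ ≤ T₂ := le_max_right _ _
    have h1 := hT₁ (p (F z)) (F (p z)) (by linarith) (by linarith)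
    have e : d (F z) - d z = fatou F ρ (p (F z)) - fatou F ρ (F (p z)) := by
      simp only [hd, hF.fatou_map hz0, hF.fatou_map hpz0]; ring
    have hx0 : p (F z) ≠ 0 := ne_zero_of_re_neg (wc_re_pos.1 (by linarith))
    have hy0 : F (p z) ≠ 0 := ne_zero_of_re_neg (wc_re_pos.1 (by linarith))
    have h2 := norm_wc_sub_wc hx0 hy0
    have hxn : ‖wc (p (F z))‖ ≤ 2 * ‖wc z‖ := by linarith [hnp (F z) hFp]
    have hyn : ‖wc (F (p z))‖ ≤ 2 * ‖wc z‖ := by linarith [hnp z hzp]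
    have h3 : ‖fatou F ρ (p (F z)) - fatou F ρ (F (p z))‖
        ≤ 3 / 2 * ‖wc (p (F z)) - wc (F (p z))‖ := by
      have := norm_sub_norm_le (fatou F ρ (p (F z)) - fatou F ρ (F (p z)))
        (wc (p (F z)) - wc (F (p z)))
      linarith
    have hzn : 0 < ‖z‖ := norm_pos_iff.2 (ne_zero_of_re_neg hz0)
    rw [e]
    calc _ ≤ 3 / 4 * (‖p (F z) - F (p z)‖ * (‖wc (p (F z))‖ * ‖wc (F (p z))‖)) := by linarith
      _ ≤ 3 / 4 * (C₁ * ‖z ^ (K + 4)‖ * ((2 * ‖wc z‖) * (2 * ‖wc z‖))) := by gcongr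
      _ = 12 * C₁ * ‖z‖ ^ (K + 2) := by
        rw [norm_wc, norm_pow]; field_simp; ring
  have hS := summable_const_div_succ_sq 1
  set S : ℝ := ∑' k : ℕ, 1 / ((k : ℝ) + 1) ^ 2
  have hS0 : 0 ≤ S := tsum_nonneg fun k => by positivity
  refine ⟨T, 12 * C₁ * 2 ^ K * 64 * S, by positivity, fun z hz => ?_⟩
  obtain ⟨hz0, hz2R, hzT, -, -, hzpre⟩ := hreg z hz
  refine ⟨(le_max_left T₀ T₁).trans_lt (by linarith), ?_⟩
  have horb : ∀ k, T < (wc (F^[k] z)).re := fun k => by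
    have := (hB.orbit hF hz0 hz2R k).1
    have hk : (0 : ℝ) ≤ k := k.cast_nonneg
    linarith
  have hzn : 0 < ‖z‖ := norm_pos_iff.2 (ne_zero_of_re_neg hz0)
  have hzk : ∀ k : ℕ, ‖d (F^[k + 1] z) - d (F^[k] z)‖
      ≤ 12 * C₁ * 2 ^ K * 64 * ‖z‖ ^ K * (1 / ((k : ℝ) + 1) ^ 2) := by
    intro k
    rw [Function.iterate_succ_apply']
    refine (hinc _ (horb k)).trans ?_
    have ho := (hB.orbit hF hz0 hz2R k).2.2
    have hk : (0 : ℝ) ≤ k := k.cast_nonneg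
    have hwp : 0 < ‖wc (F^[k] z)‖ := by linarith
    have h1 : ‖F^[k] z‖ ≤ 2 * ‖z‖ := by
      rw [norm_eq_div_norm_wc (F^[k] z), norm_eq_div_norm_wc z, ← mul_div_assoc,
        div_le_div_iff₀ hwp (by linarith)]
      linarith
    have h2 : ‖F^[k] z‖ ≤ 8 / (k + 1) := by
      rw [norm_eq_div_norm_wc (F^[k] z), div_le_div_iff₀ hwp (by positivity)]
      linarith
    calc 12 * C₁ * ‖F^[k] z‖ ^ (K + 2) = 12 * C₁ * (‖F^[k] z‖ ^ K * ‖F^[k] z‖ ^ 2) := by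
          rw [pow_add]
      _ ≤ 12 * C₁ * ((2 * ‖z‖) ^ K * (8 / (k + 1)) ^ 2) := by gcongr
      _ = _ := by rw [mul_pow, div_pow]; ring
  have hlim : Tendsto (fun n => d (F^[n] z)) atTop (𝓝 0) := by
    have h0 : Tendsto (fun n => F^[n] z) atTop (𝓝[≠] 0) :=
      tendsto_nhdsWithin_iff.2 ⟨hF.tendsto_zero z hz0, Eventually.of_forall fun n =>
        ne_zero_of_re_neg (hF.iterate_re_neg hz0 n)⟩
    have := (hF.tendsto_fatou_sub_fatou (hF.tendsto_re_wc_iterate hz0)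
      (hw.comp h0)).sub_const s
    rwa [sub_self] at this
  have hsum : ∀ n, ‖d (F^[n] z) - d z‖ ≤ 12 * C₁ * 2 ^ K * 64 * S * ‖z‖ ^ K := by
    intro n
    have e := Finset.sum_range_sub (fun k => d (F^[k] z)) n
    simp only [Function.iterate_zero, id] at e
    rw [← e]
    calc _ ≤ ∑ k ∈ Finset.range n,
          12 * C₁ * 2 ^ K * 64 * ‖z‖ ^ K * (1 / ((k : ℝ) + 1) ^ 2) :=
          norm_sum_le_of_le _ fun k _ => hzk k
      _ = 12 * C₁ * 2 ^ K * 64 * ‖z‖ ^ K * ∑ k ∈ Finset.range n, 1 / ((k : ℝ) + 1) ^ 2 := by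
          rw [Finset.mul_sum]
      _ ≤ 12 * C₁ * 2 ^ K * 64 * ‖z‖ ^ K * S := by
          gcongr
          exact hS.sum_le_tsum _ fun k _ => by positivity
      _ = _ := by ring
  have h := le_of_tendsto (hlim.sub_const (d z)).norm (Eventually.of_forall hsum)
  rwa [zero_sub, norm_neg] at h

/-- If `α(y) = α(x) + s` and `p z = z + (s / 2) z² + O(z³)` commutes with `F` up to a high order,
then `y = p(x)` up to a high order as `x` and `y` tend to `0`. Replacing `x` and `y` by `F^m(x)`
and `F^m(y)` for a fixed large `m` moves both into a region where the Abel coordinate is close to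
a translation, even if `x` tends to `0` tangentially to the imaginary axis. -/
theorem isBigO_sub_of_fatou_eq_add (hF : ParabolicMap F ρ) {p : ℂ → ℂ} {s : ℂ} (K : ℕ)
    (hp : (fun z => p z - z - s / 2 * z ^ 2) =O[𝓝 0] (fun z : ℂ => z ^ 3))
    (hc : (fun z => p (F z) - F (p z)) =O[𝓝 0] (fun z : ℂ => z ^ (K + 4)))
    {ι : Type*} {l : Filter ι} {x y : ι → ℂ} (hx : Tendsto x l (𝓝 0)) (hy : Tendsto y l (𝓝 0))
    (hxy : ∀ᶠ i in l, (x i).re < 0 ∧ (y i).re < 0 ∧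
      fatou F ρ (y i) = fatou F ρ (x i) + s) :
    (fun i => y i - p (x i)) =O[l] (fun i => x i ^ K) := by
  obtain ⟨R, CB, hB⟩ := hF.exists_stepBound
  have hR := hB.four_le
  obtain ⟨T₁, hT₁0, hT₁⟩ := hF.exists_fatou_sub_approx (by norm_num : (0 : ℝ) < 1 / 2)
  obtain ⟨T, C, hC, hT⟩ := hF.exists_norm_fatou_comp_sub_le K hp hc (max T₁ 1)
  obtain ⟨m, hm⟩ := exists_nat_gt (4 / 3 * max T (max T₁ 1))
  have hmT : max T (max T₁ 1) < 3 / 4 * m := by linarith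
  have hG := HasStrictDerivAt.iterate (0 : ℂ) hF.strict hF.map_zero m
  rw [one_pow] at hG
  have hG0 : F^[m] 0 = 0 := Function.iterate_fixed hF.map_zero m
  have hGt : Tendsto F^[m] (𝓝 0) (𝓝 0) := by
    have := hG.hasDerivAt.continuousAt.tendsto
    rwa [hG0] at this
  have hGO : (F^[m]) =O[𝓝 0] (fun z : ℂ => z) := by
    simpa [hG0] using hG.hasDerivAt.differentiableAt.isBigO_sub
  have hpt : Tendsto p (𝓝 0) (𝓝 0) := by
    have h1 : Tendsto (fun z : ℂ => z ^ 3) (𝓝 0) (𝓝 0) := by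
      simpa using (tendsto_id (α := ℂ) (x := 𝓝 0)).pow 3
    have h2 : Tendsto (fun z : ℂ => z + s / 2 * z ^ 2) (𝓝 0) (𝓝 0) :=
      Continuous.tendsto' (by fun_prop) _ _ (by simp)
    have h3 := (hp.trans_tendsto h1).add h2
    rw [add_zero] at h3
    exact h3.congr fun z => by ring
  have hpO : p =O[𝓝 0] (fun z : ℂ => z) := by
    have h1 := (hp.trans (isBigO_pow_of_le tendsto_id (by norm_num : 1 ≤ 3))).add
      (((isBigO_pow_of_le (x := fun z : ℂ => z) tendsto_id
        (by norm_num : 1 ≤ 2)).const_mul_left (s / 2)).add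
        (isBigO_pow_of_le (x := fun z : ℂ => z) tendsto_id (le_refl 1)))
    simp only [pow_one] at h1
    exact h1.congr_left fun z => by ring
  -- `p` commutes with `F^m` up to the same order
  have hcomm : ∀ n, (fun z => p (F^[n] z) - F^[n] (p z)) =O[𝓝 0] (fun z : ℂ => z ^ (K + 4)) := by
    intro n
    induction n with
    | zero => simpa using isBigO_zero _ _
    | succ n ih =>
      have hn := HasStrictDerivAt.iterate (0 : ℂ) hF.strict hF.map_zero n
      have hn0 : F^[n] 0 = 0 := Function.iterate_fixed hF.map_zero n
      have hnt : Tendsto F^[n] (𝓝 0) (𝓝 0) := by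
        have := hn.hasDerivAt.continuousAt.tendsto
        rwa [hn0] at this
      have hnO : (F^[n]) =O[𝓝 0] (fun z : ℂ => z) := by
        simpa [hn0] using hn.hasDerivAt.differentiableAt.isBigO_sub
      have h1 := (hc.comp_tendsto hnt).trans (hnO.pow (K + 4))
      have h2 : Tendsto (fun z => (p (F^[n] z), F^[n] (p z))) (𝓝 0) (𝓝 (0, 0)) :=
        (hpt.comp hnt).prodMk_nhds (hnt.comp hpt)
      have h3 := (hF.strict.isBigO_sub.comp_tendsto h2).trans ih
      refine (h1.add h3).congr_left fun z => ?_
      simp only [Function.comp_apply, Function.iterate_succ_apply']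
      ring
  have hfar : ∀ {u : ι → ℂ}, Tendsto u l (𝓝 0) → (∀ᶠ i in l, (u i).re < 0) →
      ∀ᶠ i in l, max T (max T₁ 1) < (wc (F^[m] (u i))).re := by
    intro u hu hu0
    have h1 := hu.norm
    rw [norm_zero] at h1
    filter_upwards [hu0, h1.eventually_lt_const (by positivity : 0 < 1 / R)] with i h2 h3
    have := (hB.orbit hF h2 (two_mul_le_norm_wc hR (ne_zero_of_re_neg h2) h3) m).1
    linarith [wc_re_pos.2 h2]
  have hmain : (fun i => F^[m] (y i) - p (F^[m] (x i))) =O[l] (fun i => x i ^ K) := by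
    have h1 : (fun i => F^[m] (y i) - p (F^[m] (x i))) =O[l] (fun i => F^[m] (x i) ^ K) := by
      refine IsBigO.of_bound (4 * C) ?_
      filter_upwards [hfar hx (hxy.mono fun i h => h.1), hfar hy (hxy.mono fun i h => h.2.1), hxy]
        with i hi1 hi2 hi3
      obtain ⟨hp1, hp2⟩ := hT (F^[m] (x i)) ((le_max_left _ _).trans_lt hi1)
      have hy1 : max T₁ 1 < (wc (F^[m] (y i))).re := (le_max_right _ _).trans_lt hi2
      have h1 := hT₁ _ _ ((le_max_left _ _).trans_lt hp1) ((le_max_left _ _).trans_lt hy1)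
      have e : fatou F ρ (p (F^[m] (x i))) - fatou F ρ (F^[m] (x i)) - s
          = fatou F ρ (p (F^[m] (x i))) - fatou F ρ (F^[m] (y i)) := by
        rw [hF.fatou_iterate hi3.1, hF.fatou_iterate hi3.2.1, hi3.2.2]; ring
      rw [e] at hp2
      have h2 := norm_sub_norm_le (wc (p (F^[m] (x i))) - wc (F^[m] (y i)))
        (fatou F ρ (p (F^[m] (x i))) - fatou F ρ (F^[m] (y i)))
      rw [norm_sub_rev] at h1
      have ha : 1 ≤ ‖wc (p (F^[m] (x i)))‖ :=
        (le_max_right T₁ 1).trans (hp1.le.trans (Complex.re_le_norm _))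
      have hb : 1 ≤ ‖wc (F^[m] (y i))‖ :=
        (le_max_right T₁ 1).trans (hy1.le.trans (Complex.re_le_norm _))
      have h3 := norm_wc_sub_wc
        (ne_zero_of_re_neg (wc_re_pos.1 ((hT₁0.trans_le (le_max_left _ _)).trans hp1)))
        (ne_zero_of_re_neg (wc_re_pos.1 ((hT₁0.trans_le (le_max_left _ _)).trans hy1)))
      have h4 := le_mul_of_one_le_right (norm_nonneg (p (F^[m] (x i)) - F^[m] (y i)))
        (one_le_mul_of_one_le_of_one_le ha hb)
      rw [norm_sub_rev, norm_pow]
      linarith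
    exact h1.trans ((hGO.comp_tendsto hx).pow K)
  have hcK : (fun i => p (F^[m] (x i)) - F^[m] (p (x i))) =O[l] (fun i => x i ^ K) :=
    ((hcomm m).comp_tendsto hx).trans (isBigO_pow_of_le hx (Nat.le_add_right K 4))
  have hsum : (fun i => F^[m] (y i) - F^[m] (p (x i))) =O[l] (fun i => x i ^ K) :=
    (hmain.add hcK).congr_left fun i => by ring
  have hpair : Tendsto (fun i => (y i, p (x i))) l (𝓝 (0, 0)) :=
    hy.prodMk_nhds (hpt.comp hx)
  exact ((hG.isTheta_sub one_ne_zero).isBigO_symm.comp_tendsto hpair).trans hsum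

end ParabolicMap

/-- The partial sum of order `N` of a power series, as a function. -/
def truncEval (g : PowerSeries ℂ) (N : ℕ) (z : ℂ) : ℂ :=
  ∑ k ∈ Finset.range N, PowerSeries.coeff k g * z ^ k

theorem truncEval_sub_isBigO (g : PowerSeries ℂ) {N M : ℕ} (hNM : N ≤ M) :
    (fun z => truncEval g M z - truncEval g N z) =O[𝓝 0] (fun z : ℂ => z ^ N) := by
  obtain ⟨k, rfl⟩ := Nat.exists_eq_add_of_le hNM
  have e : (fun z => truncEval g (N + k) z - truncEval g N z) =
      fun z => ∑ i ∈ Finset.range k, PowerSeries.coeff (N + i) g * z ^ (N + i) := by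
    ext z
    rw [truncEval, truncEval, Finset.sum_range_add, add_sub_cancel_left]
  rw [e]
  exact IsBigO.fun_sum fun i _ =>
    (isBigO_pow_of_le (x := fun z : ℂ => z) tendsto_id (Nat.le_add_right N i)).const_mul_left _

theorem truncEval_isFormalIterate {t : ℂ} {g : PowerSeries ℂ}
    (hg : IsFormalIterate hSeries 2 t g) {M : ℕ} (hM : 3 ≤ M) :
    (fun z => truncEval g M z - z - t / 2 * z ^ 2) =O[𝓝 0] (fun z : ℂ => z ^ 3) := by
  refine (truncEval_sub_isBigO g hM).congr_left fun z => ?_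
  have h0 : PowerSeries.coeff 0 g = 0 := hg.coeff_zero
  rw [truncEval, truncEval, Finset.sum_range_succ _ 2, Finset.sum_range_succ _ 1,
    Finset.sum_range_one, h0, hg.coeff_one, hg.coeff_m, coeff_two_hSeries]
  ring

open PowerSeries in
/-- The partial sums of a formal regular iterate commute with `h` up to their order. -/
theorem truncEval_comm_h {t : ℂ} {g : PowerSeries ℂ} (hg : IsFormalIterate hSeries 2 t g) {M : ℕ}
    (hM : 2 ≤ M) :
    (fun z => truncEval g M (h z) - h (truncEval g M z)) =O[𝓝 0] (fun z : ℂ => z ^ M) := by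
  have hg0 : constantCoeff g = 0 := by simpa using hg.coeff_zero
  set P : Polynomial ℂ := trunc M g with hP
  set Q : Polynomial ℂ := trunc M hSeries with hQ
  have htr : ∀ (f : PowerSeries ℂ) (z : ℂ), (trunc M f).eval z = truncEval f M z := by
    intro f z
    rw [truncEval, Polynomial.eval, eval₂_trunc_eq_sum_range]
    simp
  have hdiv : ∀ f : PowerSeries ℂ, X ^ M ∣ ((trunc M f : Polynomial ℂ) : PowerSeries ℂ) - f := by
    intro f
    rw [X_pow_dvd_iff]
    intro m hm
    simp [coeff_trunc, hm]
  -- the polynomial composition agrees with the formal one up to order `M`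
  have hcomp : ∀ a b : PowerSeries ℂ, constantCoeff b = 0 →
      X ^ M ∣ (((trunc M a).comp (trunc M b) : Polynomial ℂ) : PowerSeries ℂ) - subst b a := by
    intro a b hb
    have h1 := X_pow_dvd_subst_sub_sum a b hb M
    have h2 : (((trunc M a).comp (trunc M b) : Polynomial ℂ) : PowerSeries ℂ)
        = ∑ k ∈ Finset.range M, C (coeff k a) *
            ((trunc M b : Polynomial ℂ) : PowerSeries ℂ) ^ k := by
      rw [Polynomial.comp, eval₂_trunc_eq_sum_range,
        ← Polynomial.coeToPowerSeries.ringHom_apply, map_sum]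
      simp [Polynomial.coeToPowerSeries.ringHom_apply]
    have h3 : X ^ M ∣ ∑ k ∈ Finset.range M,
        C (coeff k a) * (((trunc M b : Polynomial ℂ) : PowerSeries ℂ) ^ k - b ^ k) :=
      Finset.dvd_sum fun k _ => ((hdiv b).trans (sub_dvd_pow_sub_pow _ _ _)).mul_left _
    rw [h2]
    convert dvd_sub h3 h1 using 1
    simp only [mul_sub, Finset.sum_sub_distrib]
    ring
  have hpoly : Polynomial.X ^ M ∣ P.comp Q - Q.comp P := by
    rw [Polynomial.X_pow_dvd_iff]
    intro m hm
    have h1 := dvd_sub (hcomp g hSeries constantCoeff_hSeries) (hcomp hSeries g hg0)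
    rw [hg.comm, sub_sub_sub_cancel_right] at h1
    have h2 := X_pow_dvd_iff.1 h1 m hm
    simpa using h2
  have hPQ : (fun z => P.eval (Q.eval z) - Q.eval (P.eval z)) =O[𝓝 0] (fun z : ℂ => z ^ M) := by
    obtain ⟨q, hq⟩ := hpoly
    have h1 := (isBigO_refl (fun z : ℂ => z ^ M) (𝓝 0)).mul
      ((q.continuous.tendsto 0).isBigO_one ℂ)
    simp only [mul_one] at h1
    refine h1.congr_left fun z => ?_
    have := congrArg (Polynomial.eval z) hq
    simpa [Polynomial.eval_comp] using this.symm
  have hQh : (fun z => h z - Q.eval z) =O[𝓝 0] (fun z : ℂ => z ^ M) := by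
    refine (Complex.exp_sub_sum_range_isBigO_pow M).congr_left fun z => ?_
    obtain ⟨k, rfl⟩ : ∃ k, M = k + 1 := ⟨M - 1, by omega⟩
    rw [hQ, htr, truncEval, Finset.sum_range_succ', Finset.sum_range_succ', h]
    have h0 : coeff 0 hSeries = 0 := by simp [constantCoeff_hSeries]
    rw [h0]
    simp only [coeff_hSeries (Nat.succ_ne_zero _), one_div, ← div_eq_inv_mul]
    simp
    ring
  have hP0 : P.eval 0 = 0 := by
    rw [hP, htr, truncEval, Finset.sum_eq_zero]
    intro k _
    rcases k with _ | k <;> simp [hg0]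
  have hQ0 : Q.eval 0 = 0 := by
    rw [hQ, htr, truncEval, Finset.sum_eq_zero]
    intro k _
    rcases k with _ | k <;> simp [constantCoeff_hSeries]
  have hPt : Tendsto (fun z => P.eval z) (𝓝 0) (𝓝 0) := P.continuous.tendsto' _ _ hP0
  have hQt : Tendsto (fun z => Q.eval z) (𝓝 0) (𝓝 0) := Q.continuous.tendsto' _ _ hQ0
  have hht : Tendsto h (𝓝 0) (𝓝 0) := by
    refine Continuous.tendsto' ?_ _ _ (by simp [h])
    unfold h; fun_prop
  have hPO : (fun z => P.eval z) =O[𝓝 0] (fun z : ℂ => z) := by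
    simpa [hP0] using (P.differentiableAt (x := 0)).isBigO_sub
  have h1 : (fun z => P.eval (h z) - P.eval (Q.eval z)) =O[𝓝 0] (fun z : ℂ => z ^ M) :=
    ((P.hasStrictDerivAt 0).isBigO_sub.comp_tendsto (hht.prodMk_nhds hQt)).trans hQh
  have h2 : (fun z => h (P.eval z) - Q.eval (P.eval z)) =O[𝓝 0] (fun z : ℂ => z ^ M) :=
    (hQh.comp_tendsto hPt).trans (hPO.pow M)
  refine ((h1.add hPQ).sub h2).congr_left fun z => ?_
  rw [← htr, ← htr]
  ring

end

/-! ### The two parabolic maps attached to `e^z - 1` -/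

section

open Filter Topology Asymptotics

/-- A continuous self-map of a compact set that fixes `0` and strictly decreases the norm of all
other points has all its orbits tending to `0`. -/
theorem tendsto_iterate_zero_of_norm_lt {F : ℂ → ℂ} {K : Set ℂ} (hK : IsCompact K)
    (hmaps : Set.MapsTo F K K) (hcont : ContinuousOn F K) (h0 : F 0 = 0)
    (hlt : ∀ z ∈ K, z ≠ 0 → ‖F z‖ < ‖z‖) {z : ℂ} (hz : z ∈ K) :
    Tendsto (fun n => F^[n] z) atTop (𝓝 0) := by
  have hmem : ∀ n, F^[n] z ∈ K := fun n => hmaps.iterate n hz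
  have hanti : Antitone fun n => ‖F^[n] z‖ := by
    refine antitone_nat_of_succ_le fun n => ?_
    rw [Function.iterate_succ_apply']
    rcases eq_or_ne (F^[n] z) 0 with h | h
    · rw [h, h0]
    · exact (hlt _ (hmem n) h).le
  have hbdd : BddBelow (Set.range fun n => ‖F^[n] z‖) :=
    ⟨0, by rintro _ ⟨n, rfl⟩; exact norm_nonneg _⟩
  have hlim := tendsto_atTop_ciInf hanti hbdd
  obtain ⟨a, ha, φ, hφ, hφa⟩ := hK.tendsto_subseq hmem
  have h1 : ‖a‖ = ⨅ n, ‖F^[n] z‖ :=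
    tendsto_nhds_unique hφa.norm (hlim.comp hφ.tendsto_atTop)
  have h2 : Tendsto (fun n => F (F^[φ n] z)) atTop (𝓝 (F a)) :=
    (hcont a ha).tendsto.comp (tendsto_nhdsWithin_iff.2
      ⟨hφa, Eventually.of_forall fun n => hmem (φ n)⟩)
  have h3 : Tendsto (fun n => ‖F (F^[φ n] z)‖) atTop (𝓝 (⨅ n, ‖F^[n] z‖)) := by
    have h4 := hlim.comp ((tendsto_add_atTop_nat 1).comp hφ.tendsto_atTop)
    refine h4.congr fun n => ?_
    simp only [Function.comp_apply, Function.iterate_succ_apply']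
  have h4 : ‖F a‖ = ‖a‖ := (tendsto_nhds_unique h2.norm h3).trans h1.symm
  have ha0 : a = 0 := by
    by_contra hne
    exact (hlt a ha hne).ne h4
  rw [ha0, norm_zero] at h1
  rw [← h1] at hlim
  exact tendsto_zero_iff_norm_tendsto_zero.2 hlim

theorem norm_exp_sub_one_le_of_re_nonpos {u : ℂ} (hu : u.re ≤ 0) : ‖Complex.exp u - 1‖ ≤ ‖u‖ := by
  have h := Convex.norm_image_sub_le_of_norm_deriv_le (f := Complex.exp)
    (s := {z : ℂ | z.re ≤ 0}) (C := 1) (x := 0) (y := u) (fun z _ => Complex.differentiable_exp z)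
    (fun z (hz : z.re ≤ 0) => by
      rw [Complex.deriv_exp, Complex.norm_exp]
      exact Real.exp_le_one_iff.2 hz) (convex_halfSpace_re_le 0)
    (show (0 : ℂ).re ≤ 0 by simp) hu
  simpa using h

theorem norm_h_lt {z : ℂ} (hz : z.re < 0) : ‖h z‖ < ‖z‖ := by
  have e : h z = (Complex.exp (z / 2) - 1) * (Complex.exp (z / 2) + 1) := by
    have : Complex.exp z = Complex.exp (z / 2) * Complex.exp (z / 2) := by
      rw [← Complex.exp_add]; congr 1; ring
    rw [h, this]; ring
  have hre : (z / 2).re = z.re / 2 := by simp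
  have h1 := norm_exp_sub_one_le_of_re_nonpos (u := z / 2) (by rw [hre]; linarith)
  have h2 : ‖Complex.exp (z / 2) + 1‖ < 2 := by
    refine (norm_add_le _ _).trans_lt ?_
    rw [Complex.norm_exp, norm_one, hre]
    have : Real.exp (z.re / 2) < 1 := Real.exp_lt_one_iff.2 (by linarith)
    linarith
  have hz0 : 0 < ‖z‖ := norm_pos_iff.2 (ne_zero_of_re_neg hz)
  rw [norm_div, Complex.norm_ofNat] at h1
  rw [e, norm_mul]
  calc _ ≤ ‖z‖ / 2 * ‖Complex.exp (z / 2) + 1‖ := by gcongr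
    _ < ‖z‖ / 2 * 2 := by gcongr
    _ = ‖z‖ := by ring

theorem h_re_neg {z : ℂ} (hz : z.re < 0) : (h z).re < 0 := by
  have h1 := Complex.re_le_norm (Complex.exp z)
  rw [Complex.norm_exp] at h1
  have h2 : Real.exp z.re < 1 := Real.exp_lt_one_iff.2 hz
  simp only [h, Complex.sub_re, Complex.one_re]
  linarith

theorem parabolicMap_h : ParabolicMap h (1 / 3) where
  mapsTo _ := h_re_neg
  mapsTo_petal z hz := by
    refine ⟨h_re_neg hz.1, ?_⟩
    have h1 := Complex.abs_im_le_norm (Complex.exp z)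
    rw [Complex.norm_exp] at h1
    have h2 : Real.exp z.re < 1 := Real.exp_lt_one_iff.2 hz.1
    simp only [h, Complex.sub_im, Complex.one_im, sub_zero]
    linarith [Real.pi_gt_three]
  differentiableOn := by unfold h; fun_prop
  injOn x hx y hy hxy := by
    have h1 := abs_lt.1 hx.2
    have h2 := abs_lt.1 hy.2
    exact Complex.exp_inj_of_neg_pi_lt_of_le_pi h1.1 h1.2.le h2.1 h2.2.le (by simpa [h] using hxy)
  push ε hε := by
    -- either `Re z ≤ -ε / 2` or `|Im z| ≥ θ`
    set θ : ℝ := min (ε / 2) 1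
    have hθ0 : 0 < θ := lt_min (by linarith) one_pos
    have hθ1 : θ ≤ 1 := min_le_right _ _
    have hcos : Real.cos θ < 1 := by
      rw [← Real.cos_zero]
      exact Real.cos_lt_cos_of_nonneg_of_le_pi le_rfl (by linarith [Real.pi_gt_three]) hθ0
    have hexp : Real.exp (-(ε / 2)) < 1 := Real.exp_lt_one_iff.2 (by linarith)
    refine ⟨min (1 - Real.exp (-(ε / 2))) (min 1 (1 - Real.cos θ)),
      lt_min (by linarith) (lt_min one_pos (by linarith)), fun z hz hzε => ?_⟩
    have hre : (h z).re = Real.exp z.re * Real.cos z.im - 1 := by simp [h, Complex.exp_re]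
    have hn := Complex.norm_le_abs_re_add_abs_im z
    rw [abs_of_neg hz.1] at hn
    have he0 := Real.exp_pos z.re
    rw [hre, le_neg]
    rcases le_total z.re (-(ε / 2)) with hx | hx
    · refine (min_le_left _ _).trans ?_
      have h1 : Real.exp z.re ≤ Real.exp (-(ε / 2)) := Real.exp_le_exp.2 hx
      nlinarith [Real.cos_le_one z.im]
    · refine (min_le_right _ _).trans ?_
      have hy : θ ≤ |z.im| := (min_le_left _ _).trans (by linarith)
      have h1 : Real.cos z.im ≤ Real.cos θ := by
        rw [← Real.cos_abs z.im]
        exact Real.cos_le_cos_of_nonneg_of_le_pi hθ0.le hz.2.le hy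
      have h2 : Real.exp z.re < 1 := Real.exp_lt_one_iff.2 hz.1
      rcases le_total (Real.cos z.im) 0 with h3 | h3
      · refine (min_le_left _ _).trans ?_
        nlinarith
      · refine (min_le_right _ _).trans ?_
        nlinarith
  tendsto_zero z hz := by
    -- after one step, orbits stay in the disc `|z + 1| ≤ 1`, which meets the imaginary axis
    -- only at `0`
    have hball : ∀ y : ℂ, y.re ≤ 0 → h y ∈ Metric.closedBall (-1 : ℂ) 1 := fun y hy => by
      rw [mem_closedBall_iff_norm, h, sub_neg_eq_add, sub_add_cancel, Complex.norm_exp]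
      exact Real.exp_le_one_iff.2 hy
    have hsq : ∀ y ∈ Metric.closedBall (-1 : ℂ) 1, (y.re + 1) ^ 2 + y.im ^ 2 ≤ 1 := fun y hy => by
      rw [mem_closedBall_iff_norm, sub_neg_eq_add] at hy
      have h1 := Complex.sq_norm (y + 1)
      rw [Complex.normSq_apply] at h1
      simp only [Complex.add_re, Complex.add_im, Complex.one_re, Complex.one_im, add_zero] at h1
      nlinarith [norm_nonneg (y + 1)]
    have hre : ∀ y ∈ Metric.closedBall (-1 : ℂ) 1, y.re ≤ 0 := fun y hy => by
      nlinarith [hsq y hy, sq_nonneg y.im]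
    have hreal : ∀ y ∈ Metric.closedBall (-1 : ℂ) 1, y ≠ 0 → y.re < 0 := fun y hy hy0 => by
      refine lt_of_le_of_ne (hre y hy) fun h0 => hy0 ?_
      have h1 := hsq y hy
      rw [h0] at h1
      exact Complex.ext h0 (by
        show y.im = 0
        nlinarith)
    have hcont : Continuous h := by unfold h; fun_prop
    have h1 := tendsto_iterate_zero_of_norm_lt (isCompact_closedBall (-1 : ℂ) 1)
      (fun y hy => hball y (hre y hy)) hcont.continuousOn (by simp [h])
      (fun y hy hy0 => norm_h_lt (hreal y hy hy0)) (hball z hz.le)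
    exact (tendsto_add_atTop_iff_nat 1).1 h1
  expansion := by
    refine (Complex.exp_sub_sum_range_isBigO_pow 4).congr_left fun z => ?_
    simp only [h, Finset.sum_range_succ, Finset.sum_range_zero, Nat.factorial]
    push_cast
    ring
  strict := by
    have := (Complex.hasStrictDerivAt_exp 0).sub_const 1
    rwa [Complex.exp_zero] at this
  map_zero := by simp [h]

/-- The inverse branch `log (1 + z)`, conjugated by `z ↦ -z` so that it acts on the left
half-plane, where it again has the form `z + z² / 2 + ⋯`. -/
def hFlip (z : ℂ) : ℂ := -hInv (-z)

theorem hFlip_iterate (n : ℕ) (z : ℂ) : hFlip^[n] (-z) = -hInv^[n] z := by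
  induction n with
  | zero => rfl
  | succ n ih => rw [Function.iterate_succ_apply', Function.iterate_succ_apply', ih, hFlip, neg_neg]

theorem one_le_norm_one_add {u : ℂ} (hu : 0 ≤ u.re) : 1 ≤ ‖1 + u‖ := by
  have := Complex.re_le_norm (1 + u)
  simp only [Complex.add_re, Complex.one_re] at this
  linarith

theorem one_add_mem_slitPlane {u : ℂ} (hu : 0 ≤ u.re) : 1 + u ∈ Complex.slitPlane := by
  left
  simp only [Complex.add_re, Complex.one_re]
  linarith

theorem sq_norm_one_add (u : ℂ) : ‖1 + u‖ ^ 2 = 1 + 2 * u.re + ‖u‖ ^ 2 := by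
  rw [Complex.sq_norm, Complex.sq_norm, Complex.normSq_apply, Complex.normSq_apply]
  simp only [Complex.add_re, Complex.add_im, Complex.one_re, Complex.one_im, zero_add]
  ring

theorem h_hInv {z : ℂ} (hz : 1 + z ≠ 0) : h (hInv z) = z := by
  rw [h, hInv, Complex.exp_log hz]; ring

theorem hInv_h {z : ℂ} (h₁ : -Real.pi < z.im) (h₂ : z.im ≤ Real.pi) : hInv (h z) = z := by
  rw [h, hInv, add_sub_cancel, Complex.log_exp h₁ h₂]

theorem hasDerivAt_hInv {u : ℂ} (hu : 0 ≤ u.re) : HasDerivAt hInv (1 + u)⁻¹ u := by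
  have h1 := (Complex.hasDerivAt_log (one_add_mem_slitPlane hu)).comp_const_add 1 u
  exact h1

/-- Mean value bound for `log (1 + z)` on the segment from `s u` to `u`. -/
theorem norm_hInv_sub_le {u : ℂ} (hu : 0 ≤ u.re) {q : ℝ} (hq : 0 < q) (s : ℝ) (hs0 : 0 ≤ s)
    (hs1 : s ≤ 1) (hsq : ∀ t : ℝ, s ≤ t → t ≤ 1 → q ≤ ‖1 + t * u‖) :
    ‖hInv u - hInv (s * u)‖ ≤ q⁻¹ * ((1 - s) * ‖u‖) := by
  have hmem : ∀ v ∈ segment ℝ (s * u) u, ∃ t : ℝ, s ≤ t ∧ t ≤ 1 ∧ v = t * u := by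
    rintro v ⟨a, b, ha, hb, hab, rfl⟩
    refine ⟨a * s + b, by nlinarith, by nlinarith, ?_⟩
    simp only [Complex.real_smul]
    push_cast; ring
  have h := (convex_segment (s * u : ℂ) u).norm_image_sub_le_of_norm_hasDerivWithin_le
    (f := hInv) (f' := fun v => (1 + v)⁻¹) (C := q⁻¹)
    (fun v hv => by
      obtain ⟨t, h1, h2, rfl⟩ := hmem v hv
      refine (hasDerivAt_hInv ?_).hasDerivWithinAt
      rw [Complex.re_ofReal_mul]
      exact mul_nonneg (hs0.trans h1) hu)
    (fun v hv => by
      obtain ⟨t, h1, h2, rfl⟩ := hmem v hv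
      rw [norm_inv]
      exact inv_anti₀ hq (hsq t h1 h2))
    (left_mem_segment ℝ _ _) (right_mem_segment ℝ _ _)
  refine h.trans (le_of_eq ?_)
  have e : u - s * u = ((1 - s : ℝ) : ℂ) * u := by push_cast; ring
  rw [e, norm_mul, Complex.norm_real, Real.norm_of_nonneg (by linarith)]

/-- `log (1 + z)` strictly decreases the norm: its derivative has norm at most `1` on the closed
right half-plane, and norm at most some `q⁻¹ < 1` on the outer half of the segment from `0` to
`u`. -/
theorem norm_hInv_lt {u : ℂ} (hu : 0 ≤ u.re) (hu0 : u ≠ 0) : ‖hInv u‖ < ‖u‖ := by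
  have hun : 0 < ‖u‖ := norm_pos_iff.2 hu0
  have hmono : ∀ t : ℝ, 0 ≤ t → 1 + t ^ 2 * ‖u‖ ^ 2 ≤ ‖1 + t * u‖ ^ 2 := fun t ht => by
    rw [sq_norm_one_add, Complex.re_ofReal_mul, norm_mul, Complex.norm_real, Real.norm_eq_abs,
      mul_pow, sq_abs]
    nlinarith [mul_nonneg ht hu]
  set q : ℝ := Real.sqrt (1 + ‖u‖ ^ 2 / 4) with hq
  have hq1 : 1 < q := by
    rw [hq, Real.lt_sqrt (by norm_num)]
    nlinarith
  have h1 := norm_hInv_sub_le hu (by linarith : 0 < q) (1 / 2) (by norm_num) (by norm_num)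
    fun t ht _ => by
      rw [hq]
      refine Real.sqrt_le_iff.2 ⟨norm_nonneg _, (hmono t (by linarith)).trans' ?_⟩
      have : 1 / 4 ≤ t ^ 2 := by nlinarith
      nlinarith [sq_nonneg ‖u‖]
  have hu2 : 0 ≤ (((1 / 2 : ℝ) : ℂ) * u).re := by
    rw [Complex.re_ofReal_mul]; linarith
  have h2 := norm_hInv_sub_le hu2 one_pos 0 le_rfl zero_le_one fun t ht _ =>
    one_le_norm_one_add (by rw [Complex.re_ofReal_mul]; exact mul_nonneg ht hu2)
  have h0 : hInv (((0 : ℝ) : ℂ) * (((1 / 2 : ℝ) : ℂ) * u)) = 0 := by simp [hInv]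
  rw [h0, sub_zero, norm_mul, Complex.norm_real, Real.norm_of_nonneg (by norm_num)] at h2
  have h3 : q⁻¹ < 1 := inv_lt_one_of_one_lt₀ hq1
  have h4 := norm_sub_norm_le (hInv u) (hInv (((1 / 2 : ℝ) : ℂ) * u))
  nlinarith

theorem hInv_re (z : ℂ) : (hInv z).re = Real.log ‖1 + z‖ := Complex.log_re _

theorem hInv_re_pos {z : ℂ} (hz : 0 < z.re) : 0 < (hInv z).re := by
  rw [hInv_re]
  refine Real.log_pos ?_
  have := Complex.re_le_norm (1 + z)
  simp only [Complex.add_re, Complex.one_re] at this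
  linarith

theorem abs_im_hInv_lt {z : ℂ} (hz : 0 < z.re) : |(hInv z).im| < Real.pi := by
  rw [hInv, Complex.log_im]
  have h1 : |(1 + z).arg| < Real.pi / 2 := by
    rw [Complex.abs_arg_lt_pi_div_two_iff]
    left
    simp only [Complex.add_re, Complex.one_re]
    linarith
  linarith [Real.pi_pos]

theorem hasStrictDerivAt_hInv_zero : HasStrictDerivAt hInv 1 0 := by
  have h1 : HasStrictDerivAt (fun z : ℂ => 1 + z) 1 0 := (hasStrictDerivAt_id _).const_add 1
  have h2 : HasStrictDerivAt hInv (1 / (1 + 0)) 0 := h1.clog (by simp)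
  rwa [add_zero, div_one] at h2

theorem parabolicMap_hFlip : ParabolicMap hFlip (-1 / 3) where
  mapsTo z hz := by
    have := hInv_re_pos (z := -z) (by simpa using hz)
    simpa [hFlip] using this
  mapsTo_petal z hz := by
    have h1 := hInv_re_pos (z := -z) (by simpa using hz.1)
    have h2 := abs_im_hInv_lt (z := -z) (by simpa using hz.1)
    exact ⟨by simpa [hFlip] using h1, by simpa [hFlip] using h2⟩
  differentiableOn z hz := by
    have hz : z.re < 0 := hz
    have h1 : HasDerivAt hInv _ (-z) := hasDerivAt_hInv (by simpa using hz.le)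
    exact (h1.differentiableAt.comp z differentiableAt_id.neg).neg.differentiableWithinAt
  injOn x hx y hy hxy := by
    have hne : ∀ u ∈ leftPetal, 1 + -u ≠ 0 := fun u hu =>
      Complex.slitPlane_ne_zero (one_add_mem_slitPlane (by simpa using hu.1.le))
    have h1 : hInv (-x) = hInv (-y) := neg_injective hxy
    have h2 := congrArg h h1
    rw [h_hInv (hne x hx), h_hInv (hne y hy)] at h2
    exact neg_injective h2
  push ε hε := by
    have hs : 1 < Real.sqrt (1 + ε ^ 2) := by
      rw [Real.lt_sqrt (by norm_num)]
      nlinarith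
    refine ⟨Real.log (Real.sqrt (1 + ε ^ 2)), Real.log_pos hs, fun z hz hzε => ?_⟩
    rw [hFlip, Complex.neg_re, hInv_re, neg_le_neg_iff]
    refine Real.log_le_log (by linarith) (Real.sqrt_le_iff.2 ⟨norm_nonneg _, ?_⟩)
    rw [sq_norm_one_add, norm_neg, Complex.neg_re]
    nlinarith [hz.1]
  tendsto_zero z hz := by
    have hnn : ∀ y : ℂ, y.re ≤ 0 → y ≠ 0 → ‖hFlip y‖ < ‖y‖ := fun y hy hy0 => by
      have := norm_hInv_lt (u := -y) (by simpa using hy) (by simpa using hy0)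
      simpa [hFlip] using this
    have h0 : hFlip 0 = 0 := by simp [hFlip, hInv]
    have hcont : ContinuousOn hFlip {y : ℂ | y.re ≤ -0 ∧ ‖y‖ ≤ ‖z‖} := fun y hy => by
      have hy1 : y.re ≤ 0 := by simpa using hy.1
      have h1 : HasDerivAt hInv _ (-y) := hasDerivAt_hInv (by simpa using hy1)
      exact (h1.differentiableAt.comp y differentiableAt_id.neg).neg.continuousAt.continuousWithinAt
    refine tendsto_iterate_zero_of_norm_lt (isCompact_re_le_norm_le 0 ‖z‖) ?_ hcont h0
      (fun y hy hy0 => hnn y (by simpa using hy.1) hy0) ⟨by simpa using hz.le, le_rfl⟩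
    rintro y ⟨hy1, hy2⟩
    rw [neg_zero] at hy1
    refine ⟨?_, ?_⟩
    · rw [hFlip, Complex.neg_re, hInv_re, neg_le_neg_iff]
      exact Real.log_nonneg (one_le_norm_one_add (by simpa using hy1))
    · rcases eq_or_ne y 0 with rfl | hy0
      · rw [h0]; exact hy2
      · exact (hnn y hy1 hy0).le.trans hy2
  expansion := by
    have ht : Tendsto (fun z : ℂ => -z) (𝓝 0) (𝓝 0) :=
      Continuous.tendsto' (by fun_prop) _ _ (by simp)
    have h1 := ((Complex.log_sub_logTaylor_isBigO 3).comp_tendsto ht).neg_left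
    refine (h1.congr_left fun z => ?_).congr_right fun z => ?_
    · simp only [Function.comp_apply, hFlip, hInv, Complex.logTaylor, Finset.sum_range_succ,
        Finset.sum_range_zero]
      push_cast
      ring
    · simp only [Function.comp_apply]
      ring
  strict := by
    have h1 : HasStrictDerivAt hInv 1 (-0) := by simpa using hasStrictDerivAt_hInv_zero
    have h2 : HasStrictDerivAt hFlip (-(1 * -1)) 0 :=
      (h1.comp (0 : ℂ) (hasStrictDerivAt_neg 0)).neg
    rwa [one_mul, neg_neg] at h2
  map_zero := by simp [hFlip, hInv]

end

/-! ### Regular Abel functions and limits for `e^z - 1` -/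

section

open Filter Topology Asymptotics

theorem abelIterate_spec {P : Set ℂ} {α : ℂ → ℂ} {t z : ℂ} (hz : z ∈ abelIterateDomain P α t) :
    abelIterate P α t z ∈ P ∧ α (abelIterate P α t z) = α z + t := by
  obtain ⟨-, y, hy, hyz⟩ := hz
  exact ⟨Function.invFunOn_mem ⟨y, hy, hyz⟩, Function.invFunOn_eq ⟨y, hy, hyz⟩⟩

/-- The Abel function of a parabolic map `F` gives regular Abel functions of `h` on the petal
`P = ε · leftPetal`, where `ε = ± 1`, provided the partial sums of the formal iterates of `h`,
conjugated by `ε`, commute with `F` up to their order. -/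
theorem ParabolicMap.isRegularAbel {F : ℂ → ℂ} {ρ ε c : ℂ} (hF : ParabolicMap F ρ)
    (hε : ε * ε = 1) {P : Set ℂ} (hP : ∀ z, z ∈ P ↔ ε * z ∈ leftPetal)
    (hcomm : ∀ g t, IsFormalIterate hSeries 2 t g → ∀ M, 2 ≤ M →
      (fun z => ε * truncEval g M (ε * F z) - F (ε * truncEval g M (ε * z)))
        =O[𝓝 0] (fun z : ℂ => z ^ M))
    (habel : ∀ z ∈ P, h z ∈ P → fatou F ρ (ε * h z) = fatou F ρ (ε * z) + ε)
    {β : ℂ → ℂ} (hβ : ∀ z ∈ P, β z = ε * fatou F ρ (ε * z) + c) :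
    IsRegularAbel h hSeries 2 P β := by
  have hε0 : ε ≠ 0 := left_ne_zero_of_mul_eq_one hε
  have hεn : ‖ε‖ = 1 := by
    have : ‖ε‖ * ‖ε‖ = 1 := by rw [← norm_mul, hε, norm_one]
    nlinarith [norm_nonneg ε]
  have hεε : ∀ z, ε * (ε * z) = z := fun z => by rw [← mul_assoc, hε, one_mul]
  have hmem : ∀ {z}, z ∈ P → (ε * z).re < 0 := fun hz => ((hP _).1 hz).1
  -- in the coordinate `x = ε z`, translation of `β` by `t` is translation of `fatou` by `ε t`
  have hshift : ∀ t, ∀ z ∈ P, ∀ z' ∈ P, β z' = β z + t ↔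
      fatou F ρ (ε * z') = fatou F ρ (ε * z) + ε * t := by
    intro t z hz z' hz'
    rw [hβ z hz, hβ z' hz']
    constructor
    · intro h1
      linear_combination ε * h1 + (fatou F ρ (ε * z) - fatou F ρ (ε * z')) * hε
    · intro h1
      linear_combination ε * h1 + t * hε
  refine ⟨?_, ?_, ?_, ?_, ?_⟩
  · have h1 : DifferentiableOn ℂ (fun z => ε * fatou F ρ (ε * z) + c) P :=
      ((hF.differentiableOn_fatou.comp (differentiableOn_id.const_mul ε)
        fun z hz => hmem hz).const_mul ε).add_const c
    exact h1.congr hβ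
  · intro x hx y hy hxy
    have h1 := (hshift 0 x hx y hy).1 (by rw [hxy, add_zero])
    rw [mul_zero, add_zero] at h1
    have h2 := hF.injOn_fatou ((hP y).1 hy) ((hP x).1 hx) h1
    exact (mul_left_cancel₀ hε0 h2).symm
  · intro z hz hhz
    rw [hshift 1 z hz (h z) hhz, habel z hz hhz, mul_one]
  · intro t
    rw [Metric.mem_closure_iff]
    intro δ hδ
    obtain ⟨x, hx, hxδ, x', hx', he⟩ := hF.exists_fatou_eq_add (ε * t) hδ
    have h1 : ε * x ∈ P := by rw [hP, hεε]; exact hx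
    have h2 : ε * x' ∈ P := by rw [hP, hεε]; exact hx'
    refine ⟨ε * x, ⟨h1, ε * x', h2, (hshift t _ h1 _ h2).2 (by rwa [hεε, hεε])⟩, ?_⟩
    rwa [dist_zero_left, norm_mul, hεn, one_mul]
  · intro t
    obtain ⟨g, hg⟩ := exists_isFormalIterate t
    refine ⟨g, hg, fun N => ?_⟩
    set E := abelIterateDomain P β t
    set φ := abelIterate P β t
    have hφ : ∀ z ∈ E, z ∈ P ∧ φ z ∈ P ∧
        fatou F ρ (ε * φ z) = fatou F ρ (ε * z) + ε * t := fun z hz => by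
      obtain ⟨h1, h2⟩ := abelIterate_spec hz
      exact ⟨hz.1, h1, (hshift t z hz.1 _ h1).1 h2⟩
    have hmul : Tendsto (fun z : ℂ => ε * z) (𝓝 0) (𝓝 0) :=
      Continuous.tendsto' (by fun_prop) _ _ (by simp)
    have hx : Tendsto (fun z : ℂ => ε * z) (𝓝[E] 0) (𝓝 0) := hmul.mono_left nhdsWithin_le_nhds
    have hy : Tendsto (fun z : ℂ => ε * φ z) (𝓝[E] 0) (𝓝 0) := by
      rw [Metric.tendsto_nhds]
      intro δ hδ
      obtain ⟨η, hη, hlt⟩ := hF.norm_lt_of_fatou_eq_add (ε * t) hδ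
      filter_upwards [self_mem_nhdsWithin,
        nhdsWithin_le_nhds (Metric.ball_mem_nhds (0 : ℂ) hη)] with z hz hzη
      obtain ⟨h1, h2, h3⟩ := hφ z hz
      rw [dist_zero_right]
      refine hlt (ε * z) (ε * φ z) (hmem h1) ((hP _).1 h2) ?_ h3
      rw [norm_mul, hεn, one_mul]
      simpa using hzη
    set p : ℂ → ℂ := fun z => ε * truncEval g (N + 4) (ε * z)
    have hp : (fun z => p z - z - ε * t / 2 * z ^ 2) =O[𝓝 0] (fun z : ℂ => z ^ 3) := by
      have h1 := ((truncEval_isFormalIterate hg (by omega : 3 ≤ N + 4)).comp_tendsto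
        hmul).const_mul_left ε
      have h2 : (fun z : ℂ => (ε * z) ^ 3) =O[𝓝 0] (fun z : ℂ => z ^ 3) := by
        simp only [mul_pow]
        exact isBigO_const_mul_self _ _ _
      refine (h1.trans h2).congr_left fun z => ?_
      simp only [Function.comp_apply, p]
      linear_combination (-z - ε * t / 2 * z ^ 2) * hε
    have hmain := hF.isBigO_sub_of_fatou_eq_add N hp (hcomm g t hg (N + 4) (by omega)) hx hy (by
      filter_upwards [self_mem_nhdsWithin] with z hz
      obtain ⟨h1, h2, h3⟩ := hφ z hz
      exact ⟨hmem h1, hmem h2, h3⟩)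
    have h1 : (fun z => φ z - truncEval g (N + 4) z) =O[𝓝[E] 0] (fun z : ℂ => z ^ N) := by
      have h2 : (fun z : ℂ => (ε * z) ^ N) =O[𝓝[E] 0] (fun z : ℂ => z ^ N) := by
        simp only [mul_pow]
        exact isBigO_const_mul_self _ _ _
      refine ((hmain.const_mul_left ε).trans h2).congr_left fun z => ?_
      simp only [p, hεε]
      rw [mul_sub, hεε, hεε]
    have h2 := (truncEval_sub_isBigO g (by omega : N ≤ N + 4)).mono
      (nhdsWithin_le_nhds (a := (0 : ℂ)) (s := E))
    refine (h1.add h2).congr_left fun z => ?_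
    simp only [truncEval]
    ring

/-- Conversely, a regular Abel function of `h` agrees with the Abel function of `F` up to a
constant: regularity forces the points whose `β`-coordinates differ by `t` to have Abel
coordinates differing by `t` as well. -/
theorem ParabolicMap.exists_eq_fatou_add {F : ℂ → ℂ} {ρ ε : ℂ} (hF : ParabolicMap F ρ)
    (hε : ε * ε = 1) {P : Set ℂ} (hP : ∀ z, z ∈ P ↔ ε * z ∈ leftPetal) {β : ℂ → ℂ}
    (hβ : IsRegularAbel h hSeries 2 P β) (hstep : ∀ z ∈ P, β (ε * F (ε * z)) = β z + ε) :
    ∃ c, ∀ z ∈ P, β z = ε * fatou F ρ (ε * z) + c := by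
  have hεε : ∀ z, ε * (ε * z) = z := fun z => by rw [← mul_assoc, hε, one_mul]
  have hε0 : ε ≠ 0 := left_ne_zero_of_mul_eq_one hε
  have hmem : ∀ {z}, z ∈ P → (ε * z).re < 0 := fun hz => ((hP _).1 hz).1
  have hiterP : ∀ z ∈ P, ∀ n, ε * F^[n] (ε * z) ∈ P := fun z hz n => by
    rw [hP, hεε]; exact hF.iterate_mem_petal ((hP z).1 hz) n
  have hiter : ∀ z ∈ P, ∀ n : ℕ, β (ε * F^[n] (ε * z)) = β z + ε * n := by
    intro z hz n
    induction n with
    | zero => simp [hεε]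
    | succ n ih =>
      have := hstep _ (hiterP z hz n)
      rw [hεε, ← Function.iterate_succ_apply' F n, ih] at this
      rw [this]; push_cast; ring
  have hz₀ : ε * (-1) ∈ P := by
    rw [hP, hεε]
    exact ⟨by simp, by simpa using Real.pi_pos⟩
  set z₀ : ℂ := ε * (-1)
  refine ⟨β z₀ - ε * fatou F ρ (ε * z₀), fun z hz => ?_⟩
  set t : ℂ := β z - β z₀ with ht
  suffices hsuff : fatou F ρ (ε * z) = fatou F ρ (ε * z₀) + ε * t by
    rw [hsuff]
    linear_combination (β z₀ - β z) * hε - (1 - ε * ε) * ht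
  refine hF.fatou_eq_add_of_isBigO (hmem hz₀) (hmem hz) ?_
  obtain ⟨g, hg, hasymp⟩ := hβ.regular t
  have hdom : ∀ n, ε * F^[n] (ε * z₀) ∈ abelIterateDomain P β t := fun n =>
    ⟨hiterP z₀ hz₀ n, _, hiterP z hz n, by rw [hiter z hz, hiter z₀ hz₀, ht]; ring⟩
  have hval : ∀ n, abelIterate P β t (ε * F^[n] (ε * z₀)) = ε * F^[n] (ε * z) := fun n => by
    obtain ⟨h1, h2⟩ := abelIterate_spec (hdom n)
    refine hβ.injective h1 (hiterP z hz n) ?_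
    rw [h2, hiter z hz, hiter z₀ hz₀, ht]; ring
  have hlim : Tendsto (fun n => ε * F^[n] (ε * z₀)) atTop
      (𝓝[abelIterateDomain P β t] 0) := by
    refine tendsto_nhdsWithin_iff.2 ⟨?_, Eventually.of_forall hdom⟩
    simpa using (hF.tendsto_zero _ (hmem hz₀)).const_mul ε
  have h1 := ((hasymp 3).comp_tendsto hlim).const_mul_left ε
  have h2 : ((fun z : ℂ => z ^ 3) ∘ fun n => ε * F^[n] (ε * z₀)) =O[atTop]
      fun n => (F^[n] (ε * z₀)) ^ 3 := by
    simp only [Function.comp_def, mul_pow]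
    exact isBigO_const_mul_self _ _ _
  refine (h1.trans h2).congr_left fun n => ?_
  have h0 : PowerSeries.coeff 0 g = 0 := hg.coeff_zero
  simp only [Function.comp_apply, hval, Finset.sum_range_succ, Finset.sum_range_zero, h0,
    hg.coeff_one, hg.coeff_m, coeff_two_hSeries]
  linear_combination (F^[n] (ε * z) - F^[n] (ε * z₀)
    - ε * t / 2 * (F^[n] (ε * z₀)) ^ 2) * hε

theorem tendsto_walkerLeftSeq {z : ℂ} (hz : z.re < 0) :
    Tendsto (walkerLeftSeq z) atTop (𝓝 (fatou h (1 / 3) z)) := by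
  refine (parabolicMap_h.tendsto_wc_sub_log_sub hz).congr fun n => ?_
  simp only [walkerLeftSeq, wc]; ring

theorem walkerLeft_eq {z : ℂ} (hz : z.re < 0) : walkerLeft z = fatou h (1 / 3) z :=
  (tendsto_walkerLeftSeq hz).limUnder_eq

theorem tendsto_walkerRightSeq {z : ℂ} (hz : 0 < z.re) :
    Tendsto (walkerRightSeq z) atTop (𝓝 (-fatou hFlip (-1 / 3) (-z))) := by
  refine (parabolicMap_hFlip.tendsto_wc_sub_log_sub (z := -z) (by simpa using hz)).neg.congr
    fun n => ?_
  simp only [walkerRightSeq, wc, hFlip_iterate, div_neg]; ring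

theorem walkerRight_eq {z : ℂ} (hz : 0 < z.re) :
    walkerRight z = -fatou hFlip (-1 / 3) (-z) :=
  (tendsto_walkerRightSeq hz).limUnder_eq

theorem tendsto_truncTail (v : PowerSeries ℂ) (N : ℕ) : Tendsto (truncTail v N) (𝓝 0) (𝓝 0) := by
  refine Continuous.tendsto' (by unfold truncTail; fun_prop) _ _ ?_
  refine Finset.sum_eq_zero fun k hk => ?_
  rw [zero_pow (by have := (Finset.mem_Icc.1 hk).1; omega), mul_zero]

theorem tendsto_ecalleLeftSeq (v : PowerSeries ℂ) (N : ℕ) {z : ℂ} (hz : z.re < 0) :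
    Tendsto (ecalleLeftSeq v N z) atTop (𝓝 (walkerLeft z + (Real.log 2 / 3 : ℝ))) := by
  have h1 := (parabolicMap_h.tendsto_log_neg_add_wc_sub hz).add
    ((tendsto_truncTail v N).comp (parabolicMap_h.tendsto_zero z hz))
  rw [add_zero] at h1
  rw [walkerLeft_eq hz]
  convert h1 using 2
  · simp only [ecalleLeftSeq, wc, Function.comp_apply]; ring
  · push_cast; ring

theorem tendsto_ecalleRightSeq (v : PowerSeries ℂ) (N : ℕ) {z : ℂ} (hz : 0 < z.re) :
    Tendsto (ecalleRightSeq v N z) atTop (𝓝 (walkerRight z + (Real.log 2 / 3 : ℝ))) := by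
  have hz' : (-z).re < 0 := by simpa using hz
  have h0 : Tendsto (fun n => hInv^[n] z) atTop (𝓝 0) := by
    have := (parabolicMap_hFlip.tendsto_zero (-z) hz').neg
    simpa [hFlip_iterate] using this
  have h1 := (parabolicMap_hFlip.tendsto_log_neg_add_wc_sub hz').neg.add
    ((tendsto_truncTail v N).comp h0)
  rw [add_zero] at h1
  rw [walkerRight_eq hz]
  convert h1 using 2
  · simp only [ecalleRightSeq, wc, hFlip_iterate, Function.comp_apply, neg_neg, div_neg]; ring
  · push_cast; ring

theorem mem_rightPetal_iff (z : ℂ) : z ∈ rightPetal ↔ -1 * z ∈ leftPetal := by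
  simp [rightPetal, leftPetal]

theorem hInv_mem_rightPetal {z : ℂ} (hz : z ∈ rightPetal) : hInv z ∈ rightPetal :=
  ⟨hInv_re_pos hz.1, abs_im_hInv_lt hz.1⟩

theorem h_hInv_of_re_pos {z : ℂ} (hz : 0 < z.re) : h (hInv z) = z :=
  h_hInv (Complex.slitPlane_ne_zero (one_add_mem_slitPlane hz.le))

/-- The partial sums of a formal regular iterate of `h` commute with `h⁻¹` up to their order. -/
theorem truncEval_comm_hInv {t : ℂ} {g : PowerSeries ℂ} (hg : IsFormalIterate hSeries 2 t g)
    {M : ℕ} (hM : 2 ≤ M) :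
    (fun z => truncEval g M (hInv z) - hInv (truncEval g M z)) =O[𝓝 0]
      (fun z : ℂ => z ^ M) := by
  set p := truncEval g M with hpdef
  have hp0 : p 0 = 0 := by
    refine Finset.sum_eq_zero fun k _ => ?_
    rcases k with _ | k
    · rw [hg.coeff_zero, zero_mul]
    · simp
  have hpt : Tendsto p (𝓝 0) (𝓝 0) := by
    refine Continuous.tendsto' ?_ _ _ hp0
    rw [hpdef]; unfold truncEval; fun_prop
  have hit : Tendsto hInv (𝓝 0) (𝓝 0) := by
    have := hasStrictDerivAt_hInv_zero.hasDerivAt.continuousAt.tendsto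
    simpa [hInv] using this
  have hht : Tendsto h (𝓝 0) (𝓝 0) :=
    Continuous.tendsto' (by unfold h; fun_prop) _ _ (by simp [h])
  have hiO : hInv =O[𝓝 0] (fun z : ℂ => z) := by
    have := hasStrictDerivAt_hInv_zero.hasDerivAt.differentiableAt.isBigO_sub
    simpa [show hInv 0 = 0 by simp [hInv]] using this
  have h1 := ((truncEval_comm_h hg hM).comp_tendsto hit).trans (hiO.pow M)
  have h2 : Tendsto (fun z => (h (p (hInv z)), p (h (hInv z)))) (𝓝 0) (𝓝 (0, 0)) :=
    (hht.comp (hpt.comp hit)).prodMk_nhds (hpt.comp (hht.comp hit))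
  have h3 := (hasStrictDerivAt_hInv_zero.isBigO_sub.comp_tendsto h2).trans
    (h1.neg_left.congr_left fun z => by
      simp only [Function.comp_apply]; exact neg_sub _ _)
  refine h3.congr' ?_ (EventuallyEq.refl _ _)
  have h4 : ∀ᶠ z in 𝓝 (0 : ℂ), ‖p (hInv z)‖ < 1 := by
    have := (hpt.comp hit).norm
    rw [norm_zero] at this
    exact this.eventually_lt_const one_pos
  filter_upwards [h4, Metric.ball_mem_nhds (0 : ℂ) one_pos] with z hz hz1
  have hz1 : ‖z‖ < 1 := by simpa using hz1
  have h5 : 1 + z ≠ 0 := fun h0 => by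
    have : z = -1 := by linear_combination h0
    rw [this, norm_neg, norm_one] at hz1
    exact lt_irrefl _ hz1
  have h6 := abs_le.1 ((Complex.abs_im_le_norm (p (hInv z))).trans hz.le)
  simp only [Function.comp_apply]
  rw [h_hInv h5, hInv_h (by linarith [Real.pi_gt_three]) (by linarith [Real.pi_gt_three])]

theorem isRegularAbel_leftPetal_iff (β : ℂ → ℂ) :
    IsRegularAbel h hSeries 2 leftPetal β ↔
      ∃ c : ℂ, ∀ z ∈ leftPetal, β z = walkerLeft z + c := by
  have hP : ∀ z, z ∈ leftPetal ↔ (1 : ℂ) * z ∈ leftPetal := fun z => by rw [one_mul]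
  constructor
  · intro hβ
    obtain ⟨c, hc⟩ := parabolicMap_h.exists_eq_fatou_add (one_mul 1) hP hβ fun z hz => by
      simpa using hβ.abel z hz (parabolicMap_h.mapsTo_petal z hz)
    refine ⟨c, fun z hz => ?_⟩
    rw [hc z hz, walkerLeft_eq hz.1, one_mul, one_mul]
  · rintro ⟨c, hc⟩
    refine parabolicMap_h.isRegularAbel (c := c) (one_mul 1) hP ?_ ?_ fun z hz => ?_
    · intro g t hg M hM
      simpa using truncEval_comm_h hg hM
    · intro z hz _
      simpa using parabolicMap_h.fatou_map hz.1
    · rw [hc z hz, walkerLeft_eq hz.1, one_mul, one_mul]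

theorem isRegularAbel_rightPetal_iff (β : ℂ → ℂ) :
    IsRegularAbel h hSeries 2 rightPetal β ↔
      ∃ c : ℂ, ∀ z ∈ rightPetal, β z = walkerRight z + c := by
  have hε : (-1 : ℂ) * -1 = 1 := by norm_num
  constructor
  · intro hβ
    obtain ⟨c, hc⟩ := parabolicMap_hFlip.exists_eq_fatou_add hε mem_rightPetal_iff hβ
      fun z hz => by
        have h1 := hβ.abel (hInv z) (hInv_mem_rightPetal hz) (by
          rw [h_hInv_of_re_pos hz.1]; exact hz)
        rw [h_hInv_of_re_pos hz.1] at h1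
        simp only [neg_one_mul, hFlip, neg_neg]
        rw [h1]; ring
    refine ⟨c, fun z hz => ?_⟩
    rw [hc z hz, walkerRight_eq hz.1, neg_one_mul, neg_one_mul]
  · rintro ⟨c, hc⟩
    refine parabolicMap_hFlip.isRegularAbel (c := c) hε mem_rightPetal_iff ?_ ?_ fun z hz => ?_
    · intro g t hg M hM
      have ht : Tendsto (fun z : ℂ => -z) (𝓝 0) (𝓝 0) :=
        Continuous.tendsto' (by fun_prop) _ _ (by simp)
      have h1 := ((truncEval_comm_hInv hg hM).comp_tendsto ht).neg_left
      have h2 : (fun z : ℂ => (-z) ^ M) =O[𝓝 0] (fun z : ℂ => z ^ M) := by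
        exact (isBigO_const_mul_self ((-1 : ℂ) ^ M) _ _).congr_left fun z => (neg_pow z M).symm
      refine (h1.trans h2).congr_left fun z => ?_
      simp only [Function.comp_apply, hFlip, neg_one_mul, neg_neg]
      ring
    · intro z hz hhz
      have h1 := parabolicMap_hFlip.fatou_map (z := -h z) (by simpa using hhz.1)
      have him := abs_lt.1 hz.2
      have h2 : hFlip (-h z) = -z := by
        rw [hFlip, neg_neg, hInv_h him.1 him.2.le]
      rw [h2] at h1
      rw [neg_one_mul, neg_one_mul, h1]
      ring
    · rw [hc z hz, walkerRight_eq hz.1, neg_one_mul, neg_one_mul]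

end

end WalkerAbel

end

theorem mainTheorem2 :
    -- Walker's limits exist on the half-planes and define analytic functions there
    (∀ z : ℂ, z.re < 0 → Filter.Tendsto (WalkerAbel.walkerLeftSeq z) Filter.atTop
      (nhds (WalkerAbel.walkerLeft z))) ∧
    (∀ z : ℂ, 0 < z.re → Filter.Tendsto (WalkerAbel.walkerRightSeq z) Filter.atTop
      (nhds (WalkerAbel.walkerRight z))) ∧
    DifferentiableOn ℂ WalkerAbel.walkerLeft {z : ℂ | z.re < 0} ∧
    DifferentiableOn ℂ WalkerAbel.walkerRight {z : ℂ | 0 < z.re} ∧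
    -- the Abel equation on the half-planes
    (∀ z : ℂ, z.re < 0 →
      WalkerAbel.walkerLeft (WalkerAbel.h z) = WalkerAbel.walkerLeft z + 1) ∧
    (∀ z : ℂ, 0 < z.re →
      WalkerAbel.walkerRight (WalkerAbel.hInv z) = WalkerAbel.walkerRight z - 1) ∧
    -- up to additive constants, they are the regular Abel functions on the two petals
    (∀ β : ℂ → ℂ,
      WalkerAbel.IsRegularAbel WalkerAbel.h WalkerAbel.hSeries 2 WalkerAbel.leftPetal β ↔
        ∃ c : ℂ, ∀ z ∈ WalkerAbel.leftPetal, β z = WalkerAbel.walkerLeft z + c) ∧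
    (∀ β : ℂ → ℂ,
      WalkerAbel.IsRegularAbel WalkerAbel.h WalkerAbel.hSeries 2 WalkerAbel.rightPetal β ↔
        ∃ c : ℂ, ∀ z ∈ WalkerAbel.rightPetal, β z = WalkerAbel.walkerRight z + c) ∧
    -- comparison with the limits of the truncated formal Abel function
    (∃ v : PowerSeries ℂ, WalkerAbel.IsAbelTail v ∧ ∀ N : ℕ,
      (∀ z : ℂ, z.re < 0 → Filter.Tendsto (WalkerAbel.ecalleLeftSeq v N z) Filter.atTop
        (nhds (WalkerAbel.walkerLeft z + (Real.log 2 / 3 : ℝ)))) ∧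
      (∀ z : ℂ, 0 < z.re → Filter.Tendsto (WalkerAbel.ecalleRightSeq v N z) Filter.atTop
        (nhds (WalkerAbel.walkerRight z + (Real.log 2 / 3 : ℝ))))) := by
  obtain ⟨v, hv⟩ := WalkerAbel.exists_isAbelTail
  refine ⟨fun z hz => ?_, fun z hz => ?_, ?_, ?_, fun z hz => ?_, fun z hz => ?_,
    WalkerAbel.isRegularAbel_leftPetal_iff, WalkerAbel.isRegularAbel_rightPetal_iff,
    v, hv, fun N => ⟨fun z hz => WalkerAbel.tendsto_ecalleLeftSeq v N hz,
      fun z hz => WalkerAbel.tendsto_ecalleRightSeq v N hz⟩⟩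
  · rw [WalkerAbel.walkerLeft_eq hz]
    exact WalkerAbel.tendsto_walkerLeftSeq hz
  · rw [WalkerAbel.walkerRight_eq hz]
    exact WalkerAbel.tendsto_walkerRightSeq hz
  · exact WalkerAbel.parabolicMap_h.differentiableOn_fatou.congr fun z hz =>
      WalkerAbel.walkerLeft_eq hz
  · have h1 : DifferentiableOn ℂ (fun z => -WalkerAbel.fatou WalkerAbel.hFlip (-1 / 3) (-z))
        {z : ℂ | 0 < z.re} :=
      (WalkerAbel.parabolicMap_hFlip.differentiableOn_fatou.comp differentiableOn_id.neg
        fun z (hz : 0 < z.re) => by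
          show (-z).re < 0
          simpa using hz).neg
    exact h1.congr fun z hz => WalkerAbel.walkerRight_eq hz
  · rw [WalkerAbel.walkerLeft_eq (WalkerAbel.h_re_neg hz), WalkerAbel.walkerLeft_eq hz]
    exact WalkerAbel.parabolicMap_h.fatou_map hz
  · rw [WalkerAbel.walkerRight_eq (WalkerAbel.hInv_re_pos hz), WalkerAbel.walkerRight_eq hz]
    have h1 := WalkerAbel.parabolicMap_hFlip.fatou_map (z := -z) (by simpa using hz)
    rw [WalkerAbel.hFlip, neg_neg] at h1
    rw [h1]; ring
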